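/- Let $A,D\in\mathbb C^{n\times n}$, $\lambda_0\in\mathbb C$, and let $[\Xi\ \Xi_c]\in\mathbb C^{n\times n}$ be invertible, $[\Sigma\ \Sigma_c]=[\Xi\ \Xi_c]^{-*}$, with $$A[\Xi\ \Xi_c]=[\Xi\ \Xi_c]\begin{bmatrix}\lambda_0I+N&0\\0&A_{22}\end{bmatrix},\qquad N=\operatorname{diag}(N_1,\dots,N_k),\qquad \lambda_0\notin\Lambda(A_{22}),$$ where $N_j$ consists of $j\times j$ blocks of size $s_j\times s_j$, with $I_{s_j}$ on the first block superdiagonal and $0$ elsewhere ($s_1,\dots,s_{k-1}\ge0$, $s_k>0$). Put $D_{11}=\Sigma^*D\Xi$, $D_{12}=\Sigma^*D\Xi_c$, $D_{21}=\Sigma_c^*D\Xi$, $D_{22}=\Sigma_c^*D\Xi_c$. Partition $\Xi=[\Xi_1\ \cdots\ \Xi_k]$, $\Xi_j=[\Xi_{j1}\ \cdots\ \Xi_{jj}]$ conformally with $N$, and $\Sigma$ likewise. For $1\le i\le k+1$ let $\tilde\Xi_i=[\Xi_{i1}\ \Xi_{i+1,1}\cdots\Xi_{k1}]$, $\tilde\Sigma_i=[\Sigma_{ii}\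 \Sigma_{i+1,i+1}\cdots\Sigma_{kk}]$ and $W_i=\tilde\Sigma_i^*D\tilde\Xi_i$ (so $W_{k+1}$ is void and counts as invertible). Fix $\rho\in\{1,\dots,k\}$ and suppose that $W_1,\dots,W_{\rho+1}$ are invertible. For $1\le j\le\rho$ let $G_j^{(\rho)}=-W_{\rho+1}^{-1}\tilde\Sigma_{\rho+1}^*D\Xi_{j1}$. Let $S_\rho=\Sigma_{\rho\rho}^*D\Xi_{\rho1}+\Sigma_{\rho\rho}^*D\tilde\Xi_{\rho+1}G_\rho^{(\rho)}$, and let $\Theta_\rho$ be the matrix of $\rho\times\rho$ blocks of size $s_\rho\times s_\rho$ with $I_{s_\rho}$ on the first block superdiagonal, $S_\rho$ in the lower left corner and $0$ elsewhere ($\Theta_1=S_1$). Write $z=t^{1/\rho}$ for real $t>0$. Let $L=\operatorname{diag}(L_1,\dots,L_k)$ and $R=\operatorname{diag}(R_1,\dots,R_k)$, where $L_i=\operatorname{diag}(z^{-1}I_{s_i},\dots,z^{-i}I_{s_i})$ and $R_i=\operatorname{diag}(I_{s_i},zI_{s_i},\dots,z^{i-1}I_{s_i})$ if $i\le\rho$,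 whereas for $i>\rho$ the first $i-\rho$ diagonal blocks of $L_i$ and of $R_i$ are $I_{s_i}$, and the last $\rho$ ones are $z^{-1}I_{s_i},\dots,z^{-\rho}I_{s_i}$ and $I_{s_i},zI_{s_i},\dots,z^{\rho-1}I_{s_i}$, respectively. Let $G$ be the identity matrix plus the blocks of $G_j^{(\rho)}$, $1\le j\le\rho$, placed in the columns of $\Xi_{j1}$ and in the rows corresponding to $\Xi_{\rho+1,1},\dots,\Xi_{k1}$. Then there are matrices $X(t)\in\mathbb C^{n\times\rho s_\rho}$, $\hat\Theta_\rho(t)$, $\tilde X_1(t),\dots,\tilde X_k(t)$, $P(t)$ and $Y(t)$, depending on $t$, such that for all sufficiently small $t>0$ $$(A+tD)X=X(\lambda_0I+t^{1/\rho}\hat\Theta_\rho),$$ $X$ has full column rank, and the range of $X$ is the invariant subspace of $A+tD$ corresponding to all the eigenvalues of exact order $t^{1/\rho}$; that is, there are $c_0,C_0>0$ such that for all $0<c\le c_0$ and $C\ge C_0$ and all sufficiently small $t>0$ (depending on $c,C$), the range of $X(t)$ is the sum of the generalized eigenspaces of $A+tD$ for the eigenvalues $\lambda$ with $c\,t^{1/\rho}\le|\lambda-\lambda_0|\le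 C\,t^{1/\rho}$. Moreover, as $t\to0^+$, $\hat\Theta_\rho=\Theta_\rho+O(t^{1/\rho})$ and $$X=\tilde\Xi_\rho\begin{bmatrix}I_{s_\rho}&0_{s_\rho\times(\rho-1)s_\rho}\\G_\rho^{(\rho)}&0\end{bmatrix}+\sum_{i=1}^k\Xi_i\tilde X_i+O(t),$$ where $\tilde X_\rho=\operatorname{diag}(0_{s_\rho},t^{1/\rho}I_{s_\rho},\dots,t^{1-1/\rho}I_{s_\rho})$ and, for $i\ne\rho$, the $\ell$-th block row ($1\le\ell\le i$, with $s_i$ rows) of $\tilde X_i$ is $O(t^{1-(i-\ell+1)/\rho})$ if $i<\rho$ and $O(t^{\min\{\max\{\ell-1,1\},\rho\}/\rho})$ if $i>\rho$ (so the orders of the block rows are $t^{1/\rho},t^{1/\rho},t^{2/\rho},\dots,t^{1-1/\rho},t,\dots,t$ for $i>\rho$). Here $P=O(t)$ satisfies $(A_{22}+tD_{22})P-P(\lambda_0I+N+tD_{11})-tPD_{12}P+tD_{21}=0$. The rows of $Y$ that correspond to $\Xi_\rho$ form the identity matrix, and all its other rows are $O(t^{1/\rho})$. With $\hat U=L(zI)RG$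 and $\hat V=L\bigl(N+z^\rho(D_{11}+D_{12}P)\bigr)RG$ one has $\hat UY\hat\Theta_\rho=\hat VY$; $\hat\Theta_\rho$ is the submatrix of $\hat VY$ formed by the rows that correspond to $\Xi_\rho$; and $X=(\Xi+\Xi_cP)RGY$. -/

import Mathlib

open Filter Topology Asymptotics
open scoped Matrix

namespace JordanPert

/-- The possible sizes `1, …, k` of the Jordan blocks of the eigenvalue under consideration. -/
abbrev Size (k : ℕ) : Type := {j : ℕ // j ∈ Finset.Icc 1 k}

/-- Row index of the `j`-th diagonal block: `(ℓ, a)` stands for the `a`-th row of its `(ℓ+1)`-st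
block row (`j` block rows of height `s j`; indices of `Fin` start at `0`). -/
abbrev Blk {k : ℕ} (s : ℕ → ℕ) (j : Size k) : Type := Fin j.1 × Fin (s j.1)

/-- Index set of the modified Jordan form `diag(N_1, …, N_k)`. -/
abbrev JIdx (k : ℕ) (s : ℕ → ℕ) : Type := Σ j : Size k, Blk s j

/-- Index set of `[Ξ_{i,1}, Ξ_{i+1,1}, …, Ξ_{k,1}]`; it is empty for `i = k + 1`. -/
abbrev Tail (k : ℕ) (s : ℕ → ℕ) (i : ℕ) : Type :=
  {p : Σ j : Size k, Fin (s j.1) // i ≤ p.1.1}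

/-- The position of the first block in `{1, …, j}`. -/
def fst {k : ℕ} (j : Size k) : Fin j.1 := ⟨0, (Finset.mem_Icc.1 j.2).1⟩

/-- The position of the last block in `{1, …, j}`. -/
def lst {k : ℕ} (j : Size k) : Fin j.1 := ⟨j.1 - 1, Nat.sub_lt (Finset.mem_Icc.1 j.2).1 one_pos⟩

/-- The nilpotent matrix `N = diag(N_1, …, N_k)`, where `N_j` has `j × j` blocks, with `I_{s_j}` on
the first block superdiagonal and zero elsewhere. -/
def N (k : ℕ) (s : ℕ → ℕ) : Matrix (JIdx k s) (JIdx k s) ℂ := fun p q =>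
  if p.1 = q.1 ∧ (p.2.1 : ℕ) + 1 = q.2.1 ∧ (p.2.2 : ℕ) = q.2.2 then 1 else 0

section blocks

variable {n k : ℕ} {s : ℕ → ℕ}

/-- The block column `Ξ_i` of `Ξ = [Ξ_1, …, Ξ_k]`. -/
def blockCol (Ξ : Matrix (Fin n) (JIdx k s) ℂ) (i : Size k) : Matrix (Fin n) (Blk s i) ℂ :=
  fun r x => Ξ r ⟨i, x⟩

/-- The first block column `Ξ_{i,1}` of `Ξ_i`. -/
def firstCol (Ξ : Matrix (Fin n) (JIdx k s) ℂ) (i : Size k) : Matrix (Fin n) (Fin (s i.1)) ℂ :=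
  fun r a => Ξ r ⟨i, fst i, a⟩

/-- The last block column `Σ_{i,i}` of `Σ_i`. -/
def lastCol (Sg : Matrix (Fin n) (JIdx k s) ℂ) (i : Size k) : Matrix (Fin n) (Fin (s i.1)) ℂ :=
  fun r a => Sg r ⟨i, lst i, a⟩

/-- `[Ξ_{i,1}, Ξ_{i+1,1}, …, Ξ_{k,1}]` -/
def tailFirst (Ξ : Matrix (Fin n) (JIdx k s) ℂ) (i : ℕ) : Matrix (Fin n) (Tail k s i) ℂ :=
  fun r p => Ξ r ⟨p.1.1, fst p.1.1, p.1.2⟩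

/-- `[Σ_{i,i}, Σ_{i+1,i+1}, …, Σ_{k,k}]` -/
def tailLast (Sg : Matrix (Fin n) (JIdx k s) ℂ) (i : ℕ) : Matrix (Fin n) (Tail k s i) ℂ :=
  fun r p => Sg r ⟨p.1.1, lst p.1.1, p.1.2⟩

/-- `W_i`, the product of `[Σ_{i,i}, …, Σ_{k,k}]^*`, `D` and `[Ξ_{i,1}, …, Ξ_{k,1}]`;
the empty matrix for `i = k + 1`. -/
def W (D : Matrix (Fin n) (Fin n) ℂ) (Ξ Sg : Matrix (Fin n) (JIdx k s) ℂ) (i : ℕ) :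
    Matrix (Tail k s i) (Tail k s i) ℂ :=
  (tailLast Sg i)ᴴ * D * tailFirst Ξ i

/-- `G_j^{(ρ)} = -W_{ρ+1}⁻¹ Z_{ρ+1,j}`, where `Z_{ρ+1,j}` is the product of
`[Σ_{ρ+1,ρ+1}, …, Σ_{k,k}]^*`, `D` and `Ξ_{j,1}`. -/
noncomputable def Gblk (D : Matrix (Fin n) (Fin n) ℂ) (Ξ Sg : Matrix (Fin n) (JIdx k s) ℂ)
    (ρ j : Size k) : Matrix (Tail k s (ρ.1 + 1)) (Fin (s j.1)) ℂ :=
  -((W D Ξ Sg (ρ.1 + 1))⁻¹ * ((tailLast Sg (ρ.1 + 1))ᴴ * D * firstCol Ξ j))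

/-- `S_ρ = B_{ρ1}^{(ρρ)} + [B_{ρ1}^{(ρ,ρ+1)}, …, B_{ρ1}^{(ρ,k)}] G_ρ^{(ρ)}`. -/
noncomputable def S (D : Matrix (Fin n) (Fin n) ℂ) (Ξ Sg : Matrix (Fin n) (JIdx k s) ℂ)
    (ρ : Size k) : Matrix (Fin (s ρ.1)) (Fin (s ρ.1)) ℂ :=
  (lastCol Sg ρ)ᴴ * D * firstCol Ξ ρ
    + (lastCol Sg ρ)ᴴ * D * tailFirst Ξ (ρ.1 + 1) * Gblk D Ξ Sg ρ ρ

/-- `Θ_ρ`: `ρ × ρ` blocks, with `I_{s_ρ}` on the first block superdiagonal, `S_ρ` in the lower left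
corner and zero elsewhere; `Θ_1 = S_1`. -/
noncomputable def Theta (D : Matrix (Fin n) (Fin n) ℂ) (Ξ Sg : Matrix (Fin n) (JIdx k s) ℂ)
    (ρ : Size k) : Matrix (Blk s ρ) (Blk s ρ) ℂ := fun x y =>
  (if (x.1 : ℕ) + 1 = y.1 ∧ x.2 = y.2 then 1 else 0)
    + (if x.1 = lst ρ ∧ y.1 = fst ρ then S D Ξ Sg ρ x.2 y.2 else 0)

/-- The matrix with block rows `[I_{s_ρ}, 0]` and `[G_ρ^{(ρ)}, 0]`; the rows of the first one are
those of `Tail k s ρ` outside `Tail k s (ρ+1)`. -/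
noncomputable def lead (D : Matrix (Fin n) (Fin n) ℂ) (Ξ Sg : Matrix (Fin n) (JIdx k s) ℂ)
    (ρ : Size k) : Matrix (Tail k s ρ.1) (Blk s ρ) ℂ := fun p y =>
  if y.1 = fst ρ then
    if h : ρ.1 + 1 ≤ p.1.1.1 then Gblk D Ξ Sg ρ ρ ⟨p.1, h⟩ y.2
    else if (p.1.2 : ℕ) = y.2 then 1 else 0
  else 0

/-- The scaling `L = diag(L_1, …, L_k)`. For `i ≤ ρ`, `L_i` has the diagonal blocks
`z⁻¹ I, …, z⁻ⁱ I`; for `i > ρ`, it has `i - ρ` blocks `I` and then `z⁻¹ I, …, z^{-ρ} I`.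
(Truncated subtraction covers both cases.) -/
noncomputable def L (s : ℕ → ℕ) (ρ : Size k) (z : ℂ) : Matrix (JIdx k s) (JIdx k s) ℂ :=
  Matrix.diagonal fun p => (z ^ (((p.2.1 : ℕ) + 1) - (p.1.1 - ρ.1)))⁻¹

/-- The scaling `R = diag(R_1, …, R_k)`. For `i ≤ ρ`, `R_i` has the diagonal blocks
`I, z I, …, z^{i-1} I`; for `i > ρ`, it has `i - ρ` blocks `I` and then `I, z I, …, z^{ρ-1} I`. -/
noncomputable def R (s : ℕ → ℕ) (ρ : Size k) (z : ℂ) : Matrix (JIdx k s) (JIdx k s) ℂ :=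
  Matrix.diagonal fun p => z ^ ((p.2.1 : ℕ) - (p.1.1 - ρ.1))

/-- The elimination matrix `G`: the identity plus, for `j ≤ ρ`, the blocks of `G_j^{(ρ)}` in the
first block column belonging to `j` and the first block rows belonging to `ρ+1, …, k`. -/
noncomputable def G (D : Matrix (Fin n) (Fin n) ℂ) (Ξ Sg : Matrix (Fin n) (JIdx k s) ℂ)
    (ρ : Size k) : Matrix (JIdx k s) (JIdx k s) ℂ := fun p q =>
  (if p = q then 1 else 0)
    + (if h : ρ.1 + 1 ≤ p.1.1 ∧ p.2.1 = fst p.1 ∧ q.1.1 ≤ ρ.1 ∧ q.2.1 = fst q.1 then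
        Gblk D Ξ Sg ρ q.1 ⟨⟨p.1, p.2.2⟩, h.1⟩ q.2.2 else 0)

/-- The leading matrix of the scaled pencil `μ Û(z) - V̂(z)` (up to the order of rows and columns
within the part belonging to sizes `> ρ`). -/
noncomputable def Uhat (D : Matrix (Fin n) (Fin n) ℂ) (Ξ Sg : Matrix (Fin n) (JIdx k s) ℂ)
    (ρ : Size k) (z : ℂ) : Matrix (JIdx k s) (JIdx k s) ℂ :=
  L s ρ z * (z • (1 : Matrix (JIdx k s) (JIdx k s) ℂ)) * R s ρ z * G D Ξ Sg ρ

/-- The other matrix of the scaled pencil `μ Û(z) - V̂(z)`, with `E` in the role of the perturbation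
of the nilpotent part, `V̂(z) = L (N + z^ρ E) R G`. -/
noncomputable def Vhat (D : Matrix (Fin n) (Fin n) ℂ) (Ξ Sg : Matrix (Fin n) (JIdx k s) ℂ)
    (E : Matrix (JIdx k s) (JIdx k s) ℂ) (ρ : Size k) (z : ℂ) :
    Matrix (JIdx k s) (JIdx k s) ℂ :=
  L s ρ z * (N k s + z ^ ρ.1 • E) * R s ρ z * G D Ξ Sg ρ

end blocks

/-- `t^{1/ρ}` for a real `t > 0`. -/
noncomputable def root {k : ℕ} (ρ : Size k) (t : ℝ) : ℝ := t ^ (1 / (ρ.1 : ℝ))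

/-- `F(t) = O(t^c)` entrywise as `t → 0`, `t > 0`. -/
def IsO {α β : Type*} (F : ℝ → Matrix α β ℂ) (c : ℝ) : Prop :=
  ∀ x y, (fun t => F t x y) =O[𝓝[>] (0 : ℝ)] fun t : ℝ => t ^ c

/-- The sum of the generalized eigenspaces of `M` for the eigenvalues `μ` in the annulus
`a ≤ |μ - lam| ≤ b`. -/
noncomputable def spectralSubspace {n : ℕ} (M : Matrix (Fin n) (Fin n) ℂ) (lam : ℂ) (a b : ℝ) :
    Submodule ℂ (Fin n → ℂ) :=
  ⨆ μ ∈ {μ : ℂ | a ≤ ‖μ - lam‖ ∧ ‖μ - lam‖ ≤ b},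
    Module.End.maxGenEigenspace (Matrix.toLin' M) μ

end JordanPert

/-!
A solution `P = O(t)` of a Riccati equation decouples the eigenvalues of `A + tD` near `lam` from
those near the spectrum of `A₂₂`, and reduces the claim to `N + z^ρ E` with `z = t^{1/ρ}` and
`E → D₁₁`. The scalings `L`, `R` and the elimination `G` turn this matrix into a pencil
`V̂ - μ Û` that is polynomial in `z`. At `z = 0` the coordinates belonging to the Jordan blocks of
size `ρ` span a deflating subspace with compression `Θ_ρ`, which is invertible because `W_ρ` and
`W_{ρ+1}` are, and the pencil on the quotient has no eigenvalue other than `0` and `∞`. Hence the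
implicit function theorem continues this subspace to small `z > 0`, while on every compact annulus
`c ≤ |μ| ≤ C` the quotient pencil stays invertible, so that no further eigenvalue is of order
`t^{1/ρ}`. The orders of the block rows of `X` follow from the recursion that the relation
`(N + z^ρ E) Z = z Z Θ̂` imposes along the Jordan chains, run from the first block row on for chains
longer than `ρ` and from the last one back for shorter ones.
-/

namespace JordanPert

section ImplicitFunction

variable {𝕜 : Type*} [NontriviallyNormedField 𝕜] {E F : Type*} [NormedAddCommGroup E]
  [NormedSpace 𝕜 E] [NormedAddCommGroup F] [NormedSpace 𝕜 F]

theorem hasLineDerivAt_of_add_smul_eq {f : E → F} {x v : E} {f' q : F}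
    (h : ∀ c : 𝕜, f (x + c • v) = f x + c • f' + c ^ 2 • q) : HasLineDerivAt 𝕜 f f' x v := by
  have hc := hasDerivAt_id (0 : 𝕜)
  have hd := ((hc.smul_const f').const_add (f x)).add ((hc.pow 2).smul_const q)
  have hfun : (fun c : 𝕜 => f (x + c • v)) =
      (fun c => f x + id c • f') + fun c => (id ^ 2 : 𝕜 → 𝕜) c • q := funext fun c => by simp [h c]
  simpa [HasLineDerivAt, hfun] using hd

theorem isInvertible_of_injective [CompleteSpace 𝕜] [FiniteDimensional 𝕜 E] {f : E →L[𝕜] E}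
    (hf : ∀ v, f v = 0 → v = 0) : f.IsInvertible :=
  ⟨(LinearEquiv.ofInjectiveEndo f.toLinearMap
    ((injective_iff_map_eq_zero _).2 hf)).toContinuousLinearEquiv, by ext; rfl⟩

variable [CompleteSpace F] {α : Type*} {l : Filter α} {p : α → F} {p₀ : F} {x₀ : E} {r : α → ℝ}

theorem exists_implicit_isBigO [CompleteSpace E] {f : F × E → E} {f' : F × E →L[𝕜] E}
    (hf : HasStrictFDerivAt f f' (p₀, x₀)) (hinv : (f' ∘L .inr 𝕜 F E).IsInvertible)
    (hr : Tendsto r l (𝓝 0)) (hp : (fun t => p t - p₀) =O[l] r) :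
    ∃ x : α → E, (fun t => x t - x₀) =O[l] r ∧ ∀ᶠ t in l, f (p t, x t) = f (p₀, x₀) := by
  have hx₀ : hf.implicitFunctionOfProdDomain hinv p₀ = x₀ :=
    (hf.eventually_apply_eq_iff_implicitFunctionOfProdDomain hinv).self_of_nhds.1 rfl
  have hlim : Tendsto p l (𝓝 p₀) := tendsto_sub_nhds_zero_iff.1 (hp.trans_tendsto hr)
  refine ⟨fun t => hf.implicitFunctionOfProdDomain hinv (p t), ?_,
    hlim.eventually (hf.eventually_apply_implicitFunctionOfProdDomain hinv)⟩
  have hlip := (hf.hasStrictFDerivAt_implicitFunctionOfProdDomain hinv).hasFDerivAt.isBigO_sub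
  simpa only [Function.comp_def, hx₀] using (hlip.comp_tendsto hlim).trans hp

theorem exists_implicit_isBigO_of_hasLineDerivAt {𝕜 : Type*} [RCLike 𝕜] [NormedSpace 𝕜 E]
    [NormedSpace 𝕜 F] [FiniteDimensional 𝕜 E] {f : F × E → E} (hf : ContDiff 𝕜 1 f) {f' : E → E}
    (hf' : ∀ v, HasLineDerivAt 𝕜 (fun x => f (p₀, x)) (f' v) x₀ v) (hinj : ∀ v, f' v = 0 → v = 0)
    (hr : Tendsto r l (𝓝 0)) (hp : (fun t => p t - p₀) =O[l] r) :
    ∃ x : α → E, (fun t => x t - x₀) =O[l] r ∧ ∀ᶠ t in l, f (p t, x t) = f (p₀, x₀) := by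
  have : CompleteSpace E := FiniteDimensional.complete 𝕜 E
  have hstrict : HasStrictFDerivAt f (fderiv 𝕜 f (p₀, x₀)) (p₀, x₀) :=
    hf.contDiffAt.hasStrictFDerivAt one_ne_zero
  have hpartial : HasFDerivAt (fun x => f (p₀, x)) (fderiv 𝕜 f (p₀, x₀) ∘L .inr 𝕜 F E) x₀ :=
    hstrict.hasFDerivAt.comp x₀ (hasFDerivAt_prodMk_right p₀ x₀)
  exact exists_implicit_isBigO hstrict (isInvertible_of_injective fun v hv =>
    hinj v (((hpartial.hasLineDerivAt v).unique (hf' v)).symm.trans hv)) hr hp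

end ImplicitFunction

section MatrixCalculus

attribute [local instance] Matrix.normedAddCommGroup Matrix.normedSpace

variable {ι κ γ : Type*} [Fintype ι] [Fintype κ] [Fintype γ]

section ContDiff

variable {𝕜 : Type*} [NontriviallyNormedField 𝕜] {E : Type*} [NormedAddCommGroup E]
  [NormedSpace 𝕜 E] {n : WithTop ℕ∞}

theorem contDiff_matrix_mul {f : E → Matrix ι κ 𝕜} {g : E → Matrix κ γ 𝕜} (hf : ContDiff 𝕜 n f)
    (hg : ContDiff 𝕜 n g) : ContDiff 𝕜 n fun x => f x * g x := by
  refine contDiff_pi.2 fun i => contDiff_pi.2 fun j => ?_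
  simp only [Matrix.mul_apply]
  exact ContDiff.sum fun l _ =>
    (contDiff_pi.1 (contDiff_pi.1 hf i) l).mul (contDiff_pi.1 (contDiff_pi.1 hg l) j)

theorem contDiff_matrix_diagonal [DecidableEq ι] {f : E → ι → 𝕜}
    (hf : ∀ i, ContDiff 𝕜 n fun x => f x i) : ContDiff 𝕜 n fun x => Matrix.diagonal (f x) := by
  refine contDiff_pi.2 fun i => contDiff_pi.2 fun j => ?_
  rcases eq_or_ne i j with rfl | hij
  · simpa using hf i
  · simpa [Matrix.diagonal_apply_ne _ hij] using contDiff_const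

end ContDiff

variable {α : Type*} {l : Filter α}

theorem isBigO_matrix {𝕜 F : Type*} [NormedField 𝕜] [NormedAddCommGroup F]
    {f : α → Matrix ι κ 𝕜} {r : α → F} :
    f =O[l] r ↔ ∀ i j, (fun t => f t i j) =O[l] r :=
  isBigO_pi.trans (forall_congr' fun _ => isBigO_pi)

theorem isBigO_mul_apply {𝕜 𝕜' : Type*} [NormedField 𝕜] [NormedField 𝕜'] {ι γ : Type*}
    {f : α → Matrix ι κ 𝕜} {g : α → Matrix κ γ 𝕜} {r₁ r₂ : α → 𝕜'} {i : ι} {j : γ}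
    (hf : ∀ x, (fun t => f t i x) =O[l] r₁) (hg : ∀ x, (fun t => g t x j) =O[l] r₂) :
    (fun t => (f t * g t) i j) =O[l] fun t => r₁ t * r₂ t := by
  simp only [Matrix.mul_apply]
  exact IsBigO.fun_sum fun x _ => (hf x).mul (hg x)

theorem isBigO_const_matrix_mul {𝕜 : Type*} [NormedField 𝕜] (A : Matrix ι κ 𝕜)
    {g : α → Matrix κ γ 𝕜} {r : α → ℝ} (hg : g =O[l] r) : (fun t => A * g t) =O[l] r :=
  isBigO_matrix.2 fun i j => (isBigO_mul_apply (r₁ := fun _ => 1)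
    (fun x => isBigO_const_const (A i x) one_ne_zero l) (isBigO_matrix.1 hg · j)).congr_right
    fun _ => one_mul _

theorem isBigO_matrix_mul_sub_mul {𝕜 : Type*} [NormedField 𝕜] {f : α → Matrix ι κ 𝕜}
    {g : α → Matrix κ γ 𝕜} {f₀ : Matrix ι κ 𝕜} {g₀ : Matrix κ γ 𝕜} {r : α → ℝ}
    (hr : Tendsto r l (𝓝 0)) (hf : (fun t => f t - f₀) =O[l] r) (hg : (fun t => g t - g₀) =O[l] r) :
    (fun t => f t * g t - f₀ * g₀) =O[l] r := by
  have hg_bdd : g =O[l] fun _ => (1 : ℝ) :=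
    (tendsto_sub_nhds_zero_iff.1 (hg.trans_tendsto hr)).isBigO_one ℝ
  have hsplit : ∀ t, f t * g t - f₀ * g₀ = (f t - f₀) * g t + f₀ * (g t - g₀) := fun t => by
    rw [Matrix.sub_mul, Matrix.mul_sub]
    abel
  refine isBigO_matrix.2 fun i j => ?_
  simp only [hsplit, Matrix.add_apply]
  have hleft := isBigO_mul_apply (isBigO_matrix.1 hf i) (isBigO_matrix.1 hg_bdd · j)
  have hright := isBigO_mul_apply (f := fun _ => f₀)
    (fun x => isBigO_const_const (f₀ i x) (one_ne_zero (α := ℝ)) l) fun x => isBigO_matrix.1 hg x j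
  simp only [mul_one, one_mul] at hleft hright
  exact hleft.add hright

theorem isOpen_setOf_isUnit {𝕜 : Type*} [NormedField 𝕜] [DecidableEq ι] :
    IsOpen {M : Matrix ι ι 𝕜 | IsUnit M} := by
  simp only [Matrix.isUnit_iff_isUnit_det, isUnit_iff_ne_zero]
  exact isOpen_ne_fun continuous_id.matrix_det continuous_const

theorem eventually_isUnit_of_tendsto {𝕜 : Type*} [NormedField 𝕜] [DecidableEq ι]
    {B : α → Matrix ι ι 𝕜} {B₀ : Matrix ι ι 𝕜} (hB : Tendsto B l (𝓝 B₀)) (hB₀ : IsUnit B₀) :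
    ∀ᶠ t in l, IsUnit (B t) :=
  hB.eventually (isOpen_setOf_isUnit.mem_nhds hB₀)

end MatrixCalculus

section GeneralizedEigenspaces

variable {R M M' : Type*} [CommRing R] [AddCommGroup M] [Module R M] [AddCommGroup M'] [Module R M']

theorem maxGenEigenspace_le {f : Module.End R M} {S : Submodule R M} {μ : R}
    (h : ∀ v, f v - μ • v ∈ S → v ∈ S) : f.maxGenEigenspace μ ≤ S := by
  intro x hx
  obtain ⟨d, hd⟩ := (Module.End.mem_maxGenEigenspace _ _ _).1 hx
  have hpow : ((f - μ • (1 : Module.End R M)) ^ d) x ∈ S := hd ▸ S.zero_mem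
  clear hx hd
  induction d generalizing x with
  | zero => simpa using hpow
  | succ d ih =>
    rw [pow_succ, Module.End.mul_apply] at hpow
    exact h x (by simpa using ih hpow)

theorem map_maxGenEigenspace_le {f : Module.End R M} {g : Module.End R M'} {h : M' →ₗ[R] M}
    {lam z : R} (hfg : ∀ x, f (h x) = lam • h x + z • h (g x)) (μ : R) :
    (g.maxGenEigenspace μ).map h ≤ f.maxGenEigenspace (lam + z * μ) := by
  have hstep : ∀ x, (f - (lam + z * μ) • (1 : Module.End R M)) (h x) =
      z • h ((g - μ • (1 : Module.End R M')) x) := fun x => by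
    simp only [LinearMap.sub_apply, LinearMap.smul_apply, Module.End.one_apply, hfg, map_sub,
      map_smul, smul_sub, add_smul, smul_smul, LinearMap.add_apply]
    abel
  have hpow : ∀ (d : ℕ) (x : M'), ((f - (lam + z * μ) • (1 : Module.End R M)) ^ d) (h x) =
      z ^ d • h (((g - μ • (1 : Module.End R M')) ^ d) x) := fun d => by
    induction d with
    | zero => simp
    | succ d ih =>
      intro x
      rw [pow_succ, Module.End.mul_apply, hstep, map_smul, ih, smul_smul, ← pow_succ',
        ← Module.End.mul_apply, ← pow_succ]
  rintro _ ⟨x, hx, rfl⟩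
  obtain ⟨d, hd⟩ := (Module.End.mem_maxGenEigenspace _ _ _).1 hx
  exact (Module.End.mem_maxGenEigenspace _ _ _).2 ⟨d, by rw [hpow, hd, map_zero, smul_zero]⟩

theorem iSup_spectrum_maxGenEigenspace_eq_top {K V : Type*} [Field K] [IsAlgClosed K]
    [AddCommGroup V] [Module K V] [FiniteDimensional K V] (f : Module.End K V) :
    ⨆ μ ∈ spectrum K f, f.maxGenEigenspace μ = ⊤ := by
  rw [eq_top_iff, ← f.iSup_maxGenEigenspace_eq_top, iSup_le_iff]
  intro μ
  by_cases hμ : μ ∈ spectrum K f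
  · exact le_iSup₂_of_le μ hμ le_rfl
  · refine (maxGenEigenspace_le (S := ⊥) fun v hv => ?_).trans bot_le
    rw [← Module.End.hasEigenvalue_iff_mem_spectrum, Module.End.hasEigenvalue_iff, not_not] at hμ
    exact hμ ▸ Module.End.mem_eigenspace_iff.2 (sub_eq_zero.1 hv)

end GeneralizedEigenspaces

section Sylvester

variable {K : Type*} [Field K] [IsAlgClosed K] {ι κ γ : Type*} [Fintype ι] [Fintype κ]
  [DecidableEq κ]

theorem eq_zero_of_mul_mul_eq {U V : Matrix γ ι K} {Q : Matrix κ κ K} {M : Matrix ι κ K}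
    (h : U * M * Q = V * M)
    (hreg : ∀ μ ∈ spectrum K Q, ∀ w, V *ᵥ w = μ • U *ᵥ w → w = 0) : M = 0 := by
  suffices hker : LinearMap.ker (Matrix.toLin' M) = ⊤ by
    simpa using LinearMap.ker_eq_top.1 hker
  rw [eq_top_iff, ← iSup_spectrum_maxGenEigenspace_eq_top (Matrix.toLin' Q), iSup₂_le_iff]
  intro μ hμ
  refine maxGenEigenspace_le fun v hv => hreg μ (by simpa [Matrix.spectrum_toLin'] using hμ) _ ?_
  have hMQv : M *ᵥ (Q *ᵥ v) = μ • M *ᵥ v := by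
    simpa [Matrix.mulVec_sub, Matrix.mulVec_smul, sub_eq_zero] using hv
  simp only [Matrix.toLin'_apply]
  rw [Matrix.mulVec_mulVec, ← h, ← Matrix.mulVec_mulVec, ← Matrix.mulVec_mulVec, hMQv,
    Matrix.mulVec_smul]

variable [DecidableEq ι]

theorem eq_zero_of_mul_eq_mul_of_disjoint {B : Matrix ι ι K} {C : Matrix κ κ K}
    (hBC : Disjoint (spectrum K B) (spectrum K C)) {M : Matrix ι κ K} (h : B * M = M * C) :
    M = 0 := by
  refine eq_zero_of_mul_mul_eq (U := 1) (V := B) (Q := C) (by simpa using h.symm)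
    fun μ hμ w hw => ?_
  have hunit := spectrum.notMem_iff.1 fun hB => Set.disjoint_left.1 hBC hB hμ
  refine Matrix.mulVec_injective_of_isUnit hunit ?_
  simpa [Matrix.sub_mulVec, Algebra.algebraMap_eq_smul_one, Matrix.smul_mulVec, sub_eq_zero]
    using hw.symm

end Sylvester

section Riccati

attribute [local instance] Matrix.normedAddCommGroup Matrix.normedSpace

variable {ι κ : Type*} [Fintype ι] [DecidableEq ι] [Fintype κ] [DecidableEq κ]

theorem exists_riccati {B : Matrix ι ι ℂ} {C : Matrix κ κ ℂ}
    (hBC : Disjoint (spectrum ℂ B) (spectrum ℂ C)) (D₁₁ : Matrix κ κ ℂ) (D₁₂ : Matrix κ ι ℂ)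
    (D₂₁ : Matrix ι κ ℂ) (D₂₂ : Matrix ι ι ℂ) :
    ∃ P : ℝ → Matrix ι κ ℂ, IsO P 1 ∧ ∀ᶠ t : ℝ in 𝓝[>] 0,
      (B + (t : ℂ) • D₂₂) * P t - P t * (C + (t : ℂ) • D₁₁)
        - (t : ℂ) • (P t * D₁₂ * P t) + (t : ℂ) • D₂₁ = 0 := by
  let f : ℂ × Matrix ι κ ℂ → Matrix ι κ ℂ := fun x =>
    (B + x.1 • D₂₂) * x.2 - x.2 * (C + x.1 • D₁₁) - x.1 • (x.2 * D₁₂ * x.2) + x.1 • D₂₁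
  have hf : ContDiff ℂ 1 f := by
    have ht : ContDiff ℂ 1 fun x : ℂ × Matrix ι κ ℂ => x.1 := contDiff_fst
    have hP : ContDiff ℂ 1 fun x : ℂ × Matrix ι κ ℂ => x.2 := contDiff_snd
    exact (((contDiff_matrix_mul (contDiff_const.add (ht.smul contDiff_const)) hP).sub
      (contDiff_matrix_mul hP (contDiff_const.add (ht.smul contDiff_const)))).sub
      (ht.smul (contDiff_matrix_mul (contDiff_matrix_mul hP contDiff_const) hP))).add
      (ht.smul contDiff_const)
  have hlin : ∀ Q, HasLineDerivAt ℂ (fun P => f (0, P)) (B * Q - Q * C) 0 Q := fun Q =>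
    hasLineDerivAt_of_add_smul_eq (q := 0) fun c => by simp [f, smul_sub]
  have ht : (fun t : ℝ => (t : ℂ) - 0) =O[𝓝[>] 0] fun t : ℝ => t := by
    simpa using Complex.isBigO_ofReal_left.2 (isBigO_refl (fun t : ℝ => t) _)
  have hr : Tendsto (fun t : ℝ => t) (𝓝[>] 0) (𝓝 0) := nhdsWithin_le_nhds
  obtain ⟨P, hP, hsol⟩ := exists_implicit_isBigO_of_hasLineDerivAt hf hlin
    (fun Q hQ => eq_zero_of_mul_eq_mul_of_disjoint hBC (sub_eq_zero.1 hQ)) hr ht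
  exact ⟨P, fun x y => by simpa using isBigO_matrix.1 hP x y, by simpa [f] using hsol⟩

end Riccati

section SplitPencil

attribute [local instance] Matrix.normedAddCommGroup Matrix.normedSpace

variable {𝕜 ι β : Type*} [Field 𝕜] [Fintype ι] [Fintype β] [DecidableEq β]

/-- The columns of `J` span a deflating subspace of the pencil `V - μ U`, with invertible
compression `Θ`, and the pencil induced on the quotient by this subspace, identified with the
kernel of `K`, has no eigenvalue other than `0` and `∞`. -/
structure SplitPencil (K : Matrix β ι 𝕜) (J : Matrix ι β 𝕜) (U V : Matrix ι ι 𝕜)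
    (Θ : Matrix β β 𝕜) : Prop where
  left_inv : K * J = 1
  mul_U : K * U = K
  U_mul : U * J = J
  V_mul : V * J = J * Θ
  isUnit : IsUnit Θ
  eq_zero_of_quotient : ∀ μ : 𝕜, μ ≠ 0 → ∀ w, K *ᵥ w = 0 →
    (∃ b, V *ᵥ w - μ • U *ᵥ w = J *ᵥ b) → w = 0

variable {K : Matrix β ι 𝕜} {J : Matrix ι β 𝕜} {U V : Matrix ι ι 𝕜} {Y : Matrix ι β 𝕜}
  {Θ : Matrix β β 𝕜} {μ : 𝕜} {w : ι → 𝕜}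

/-- The pencil that `V - μ U` induces between the quotients by the ranges of `Y` and `U * Y`, made
square by the identity on the rows selected by `K`. -/
noncomputable def quotientPencil [DecidableEq ι] (K : Matrix β ι 𝕜) (J : Matrix ι β 𝕜)
    (U V : Matrix ι ι 𝕜) (Y : Matrix ι β 𝕜) (μ : 𝕜) : Matrix ι ι 𝕜 :=
  J * K + (1 - U * Y * K) * (V - μ • U)

theorem exists_eq_mulVec_of_isUnit_quotientPencil [DecidableEq ι]
    (hunit : IsUnit (quotientPencil K J U V Y μ)) (hU : K * U = K) (hY : K * Y = 1)
    {Q : Matrix β β 𝕜} (hQ : U * Y * Q = V * Y) {a : β → 𝕜}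
    (hw : V *ᵥ w - μ • U *ᵥ w = (U * Y) *ᵥ a) : ∃ b, w = Y *ᵥ b := by
  refine ⟨K *ᵥ w, sub_eq_zero.1 (Matrix.mulVec_injective_of_isUnit hunit ?_)⟩
  have hpencil : (V - μ • U) *ᵥ (w - Y *ᵥ (K *ᵥ w)) =
      (U * Y) *ᵥ (a - Q *ᵥ (K *ᵥ w) + μ • K *ᵥ w) := by
    have hYw : (V - μ • U) *ᵥ (Y *ᵥ (K *ᵥ w)) = (U * Y) *ᵥ (Q *ᵥ (K *ᵥ w) - μ • K *ᵥ w) := by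
      rw [Matrix.mulVec_mulVec, Matrix.sub_mul, Matrix.smul_mul, ← hQ, Matrix.sub_mulVec,
        Matrix.smul_mulVec, ← Matrix.mulVec_mulVec, Matrix.mulVec_sub, Matrix.mulVec_smul]
    rw [Matrix.mulVec_sub, hYw, Matrix.sub_mulVec, Matrix.smul_mulVec, hw, ← Matrix.mulVec_sub]
    congr 1
    abel
  have hproj : (1 - U * Y * K) * (U * Y) = 0 := by
    rw [Matrix.sub_mul, Matrix.one_mul, Matrix.mul_assoc (U * Y), ← Matrix.mul_assoc K U, hU, hY,
      Matrix.mul_one, sub_self]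
  simp only [quotientPencil, Matrix.add_mulVec, ← Matrix.mulVec_mulVec, hpencil, Matrix.mulVec_zero]
  simp only [Matrix.mulVec_mulVec, hproj, Matrix.zero_mulVec, add_zero, Matrix.mulVec_sub]
  simp [← Matrix.mul_assoc, hY]

namespace SplitPencil

theorem eq_zero_of_quotientPencil_mulVec [DecidableEq ι] (h : SplitPencil K J U V Θ) (hμ : μ ≠ 0)
    (hw : quotientPencil K J U V J μ *ᵥ w = 0) : w = 0 := by
  rw [quotientPencil, h.U_mul, Matrix.add_mulVec, ← Matrix.mulVec_mulVec,
    ← Matrix.mulVec_mulVec] at hw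
  have hproj : K * (1 - J * K) = 0 := by rw [Matrix.mul_sub, ← Matrix.mul_assoc, h.left_inv]; simp
  have hKw : K *ᵥ w = 0 := by
    simpa [Matrix.mulVec_add, Matrix.mulVec_mulVec, ← Matrix.mul_assoc, hproj, h.left_inv]
      using congrArg (K *ᵥ ·) hw
  refine h.eq_zero_of_quotient μ hμ w hKw ⟨K *ᵥ (V - μ • U) *ᵥ w, ?_⟩
  rw [hKw, Matrix.mulVec_zero, zero_add, Matrix.sub_mulVec, Matrix.one_mulVec, sub_eq_zero,
    ← Matrix.mulVec_mulVec] at hw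
  rw [← hw, Matrix.sub_mulVec, Matrix.smul_mulVec]

theorem isUnit_quotientPencil [DecidableEq ι] (h : SplitPencil K J U V Θ) (hμ : μ ≠ 0) :
    IsUnit (quotientPencil K J U V J μ) :=
  Matrix.mulVec_injective_iff_isUnit.1 <|
    (injective_iff_map_eq_zero (Matrix.mulVecLin _)).2 fun _ =>
      h.eq_zero_of_quotientPencil_mulVec hμ

theorem eq_zero_of_mul_right_eq [IsAlgClosed 𝕜] (h : SplitPencil K J U V Θ)
    {M : Matrix ι β 𝕜} (hM : K * M = 0) {B : Matrix β β 𝕜}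
    (hB : V * M - U * M * Θ = J * B) : M = 0 := by
  classical
  have hproj : (1 - J * K) * J = 0 := by rw [Matrix.sub_mul, Matrix.mul_assoc, h.left_inv]; simp
  refine eq_zero_of_mul_mul_eq (U := (1 - J * K) * U) (V := J * K + (1 - J * K) * V) (Q := Θ) ?_
    fun μ hμ w hw => ?_
  · have := congrArg ((1 - J * K) * ·) hB
    simp only [Matrix.mul_sub, ← Matrix.mul_assoc, hproj, Matrix.zero_mul, sub_eq_zero] at this
    rw [Matrix.add_mul, Matrix.mul_assoc J K M, hM, Matrix.mul_zero, zero_add, this]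
  · have hμ0 : μ ≠ 0 := fun h0 => spectrum.zero_notMem 𝕜 h.isUnit (h0 ▸ hμ)
    refine h.eq_zero_of_quotientPencil_mulVec hμ0 ?_
    rw [quotientPencil, h.U_mul, Matrix.mul_sub, Matrix.mul_smul, ← add_sub_assoc,
      Matrix.sub_mulVec, Matrix.smul_mulVec, hw, sub_self]

theorem eq_zero_of_linearization [IsAlgClosed 𝕜] (h : SplitPencil K J U V Θ) {M : Matrix ι β 𝕜}
    (hM : J * (K * (V * M)) + U * M * Θ - V * M = 0) : M = 0 := by
  have hKM : K * M = 0 := by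
    have hrows : K * M * Θ = 0 := by
      have := congrArg (K * ·) hM
      rwa [Matrix.mul_sub, Matrix.mul_add, ← Matrix.mul_assoc K J, h.left_inv, Matrix.one_mul,
        add_sub_cancel_left, ← Matrix.mul_assoc, ← Matrix.mul_assoc, h.mul_U,
        Matrix.mul_zero] at this
    have := congrArg (· * Θ⁻¹) hrows
    rwa [Matrix.mul_nonsing_inv_cancel_right _ _ ((Matrix.isUnit_iff_isUnit_det _).1 h.isUnit),
      Matrix.zero_mul] at this
  exact h.eq_zero_of_mul_right_eq hKM (sub_eq_iff_eq_add.2 (sub_eq_zero.1 hM).symm)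

end SplitPencil

section Perturbation

variable {E : Type*} [NormedAddCommGroup E] [NormedSpace ℂ E] {U V : E → Matrix ι ι ℂ} {p₀ : E}
  {K : Matrix β ι ℂ} {J : Matrix ι β ℂ} {Θ : Matrix β β ℂ}
  {α : Type*} {l : Filter α} {p : α → E} {r : α → ℝ}

theorem SplitPencil.exists_deflating [CompleteSpace E] (h : SplitPencil K J (U p₀) (V p₀) Θ)
    (hU : ContDiff ℂ 1 U) (hV : ContDiff ℂ 1 V) (hr : Tendsto r l (𝓝 0))
    (hp : (fun t => p t - p₀) =O[l] r) :
    ∃ Y : α → Matrix ι β ℂ, (fun t => Y t - J) =O[l] r ∧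
      ∀ᶠ t in l, U (p t) * Y t * (K * (V (p t) * Y t)) = V (p t) * Y t := by
  let f : E × Matrix ι β ℂ → Matrix ι β ℂ := fun x =>
    U x.1 * x.2 * (K * (V x.1 * x.2)) - V x.1 * x.2
  have hf : ContDiff ℂ 1 f := by
    have hY : ContDiff ℂ 1 fun x : E × Matrix ι β ℂ => x.2 := contDiff_snd
    have hVY := contDiff_matrix_mul (hV.comp contDiff_fst) hY
    exact (contDiff_matrix_mul (contDiff_matrix_mul (hU.comp contDiff_fst) hY)
      (contDiff_matrix_mul contDiff_const hVY)).sub hVY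
  have hKJ : ∀ M : Matrix β β ℂ, K * (J * M) = M := fun M => by
    rw [← Matrix.mul_assoc, h.left_inv, Matrix.one_mul]
  have hlin : ∀ M : Matrix ι β ℂ, HasLineDerivAt ℂ (fun Y => f (p₀, Y))
      (J * (K * (V p₀ * M)) + U p₀ * M * Θ - V p₀ * M) J M := fun M =>
    hasLineDerivAt_of_add_smul_eq (q := U p₀ * M * (K * (V p₀ * M))) fun c => by
      simp only [f, Matrix.mul_add, Matrix.mul_smul, Matrix.add_mul, Matrix.smul_mul, h.U_mul,
        h.V_mul, hKJ, smul_sub, smul_add, smul_smul, pow_two]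
      abel
  obtain ⟨Y, hY, hsol⟩ := exists_implicit_isBigO_of_hasLineDerivAt hf hlin
    (fun M hM => h.eq_zero_of_linearization hM) hr hp
  refine ⟨Y, hY, hsol.mono fun t ht => sub_eq_zero.1 (ht.trans ?_)⟩
  simp only [f, h.U_mul, h.V_mul, hKJ, sub_self]

end Perturbation

theorem mul_eq_one_of_deflating {Q : Matrix β β 𝕜} (hU : K * U = K) (hQ : IsUnit Q)
    (hdef : U * Y * Q = V * Y) (hKQ : K * (V * Y) = Q) : K * Y = 1 := by
  have hmul : K * Y * Q = 1 * Q := by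
    rw [← hU, Matrix.mul_assoc K U, Matrix.mul_assoc, hdef, hKQ, Matrix.one_mul]
  exact hQ.mul_right_cancel hmul

theorem SplitPencil.eventually_isUnit_quotientPencil {𝕜 : Type*} [NormedField 𝕜] [ProperSpace 𝕜]
    [DecidableEq ι] {K : Matrix β ι 𝕜} {J : Matrix ι β 𝕜} {U V : Matrix ι ι 𝕜} {Θ : Matrix β β 𝕜}
    (h : SplitPencil K J U V Θ)
    {α : Type*} {l : Filter α} {Ut Vt : α → Matrix ι ι 𝕜} {Yt : α → Matrix ι β 𝕜}
    (hU : Tendsto Ut l (𝓝 U)) (hV : Tendsto Vt l (𝓝 V)) (hY : Tendsto Yt l (𝓝 J)) {c C : ℝ}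
    (hc : 0 < c) :
    ∀ᶠ t in l, ∀ μ : 𝕜, c ≤ ‖μ‖ → ‖μ‖ ≤ C → IsUnit (quotientPencil K J (Ut t) (Vt t) (Yt t) μ) := by
  have hannulus : IsCompact {μ : 𝕜 | c ≤ ‖μ‖ ∧ ‖μ‖ ≤ C} := by
    refine (isCompact_closedBall (0 : 𝕜) C).of_isClosed_subset ?_ fun μ hμ => by simpa using hμ.2
    exact (isClosed_le continuous_const continuous_norm).inter
      (isClosed_le continuous_norm continuous_const)
  have hcont : Continuous fun x : (Matrix ι ι 𝕜 × Matrix ι ι 𝕜 × Matrix ι β 𝕜) × 𝕜 =>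
      quotientPencil K J x.1.1 x.1.2.1 x.1.2.2 x.2 := by
    unfold quotientPencil
    fun_prop
  have hnhds := hannulus.eventually_forall_of_forall_eventually (x₀ := (U, V, J))
    (P := fun x μ => IsUnit (quotientPencil K J x.1 x.2.1 x.2.2 μ)) fun μ hμ =>
      hcont.continuousAt.eventually (isOpen_setOf_isUnit.mem_nhds
        (h.isUnit_quotientPencil (norm_pos_iff.1 (hc.trans_le hμ.1))))
  filter_upwards [(hU.prodMk_nhds (hV.prodMk_nhds hY)).eventually hnhds] with t ht μ hcμ hμC
  exact ht μ ⟨hcμ, hμC⟩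

end SplitPencil

section SpectralPerturbation

variable {𝕜 A : Type*} [NormedField 𝕜] [ProperSpace 𝕜] [NormedRing A] [NormedAlgebra 𝕜 A]
  [CompleteSpace A] {α : Type*} {l : Filter α} {a : α → A} {a₀ : A}

theorem eventually_spectrum_subset (ha : Tendsto a l (𝓝 a₀)) {O : Set 𝕜} (hO : IsOpen O)
    (hsub : spectrum 𝕜 a₀ ⊆ O) : ∀ᶠ t in l, spectrum 𝕜 (a t) ⊆ O := by
  filter_upwards [ha.eventually (upperHemicontinuousAt_iff.1
    (upperHemicontinuous_iff.1 (upperHemicontinuous_spectrum 𝕜 A) a₀) O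
    (hO.mem_nhdsSet.2 hsub))] with t ht
  exact subset_of_mem_nhdsSet ht

theorem exists_eventually_le_norm_sub_of_mem_spectrum (ha : Tendsto a l (𝓝 a₀)) {lam : 𝕜}
    (hlam : lam ∉ spectrum 𝕜 a₀) :
    ∃ r > 0, ∀ᶠ t in l, ∀ μ ∈ spectrum 𝕜 (a t), r ≤ ‖μ - lam‖ := by
  obtain ⟨r, hr, hball⟩ := Metric.isOpen_iff.1 (spectrum.isClosed a₀).isOpen_compl lam hlam
  have hsub : spectrum 𝕜 a₀ ⊆ {μ | r / 2 < ‖μ - lam‖} := fun μ hμ =>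
    (half_lt_self hr).trans_le (not_lt.1 fun hlt => hball (mem_ball_iff_norm.2 hlt) hμ)
  refine ⟨r / 2, half_pos hr, ?_⟩
  filter_upwards [eventually_spectrum_subset ha
    (isOpen_lt continuous_const (continuous_id.sub continuous_const).norm) hsub] with t ht μ hμ
  exact (ht hμ).le

theorem exists_eventually_norm_le_of_mem_spectrum (ha : Tendsto a l (𝓝 a₀)) :
    ∃ C > 0, ∀ᶠ t in l, ∀ μ ∈ spectrum 𝕜 (a t), ‖μ‖ ≤ C := by
  refine ⟨‖a₀‖ * ‖(1 : A)‖ + 1, by positivity, ?_⟩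
  have hsub : spectrum 𝕜 a₀ ⊆ {μ | ‖μ‖ < ‖a₀‖ * ‖(1 : A)‖ + 1} := fun μ hμ =>
    (spectrum.norm_le_norm_mul_of_mem hμ).trans_lt (lt_add_one _)
  filter_upwards [eventually_spectrum_subset ha (isOpen_lt continuous_norm continuous_const)
    hsub] with t ht μ hμ
  exact (ht hμ).le

end SpectralPerturbation

section MatrixSpectrum

variable {ι : Type*} [Fintype ι] [DecidableEq ι] {α : Type*} {l : Filter α}
  {B : α → Matrix ι ι ℂ} {B₀ : Matrix ι ι ℂ}

theorem exists_annulus_of_isUnit (hB : Tendsto B l (𝓝 B₀)) (hB₀ : IsUnit B₀) :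
    ∃ c₀ C₀ : ℝ, 0 < c₀ ∧ 0 < C₀ ∧
      ∀ᶠ t in l, ∀ μ ∈ spectrum ℂ (B t), c₀ ≤ ‖μ‖ ∧ ‖μ‖ ≤ C₀ := by
  let _ : NormedRing (Matrix ι ι ℂ) := Matrix.linftyOpNormedRing
  let _ : NormedAlgebra ℂ (Matrix ι ι ℂ) := Matrix.linftyOpNormedAlgebra
  obtain ⟨c₀, hc₀, hlower⟩ :=
    exists_eventually_le_norm_sub_of_mem_spectrum hB (spectrum.zero_notMem ℂ hB₀)
  obtain ⟨C₀, hC₀, hupper⟩ := exists_eventually_norm_le_of_mem_spectrum (𝕜 := ℂ) hB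
  refine ⟨c₀, C₀, hc₀, hC₀, ?_⟩
  filter_upwards [hlower, hupper] with t hlower hupper μ hμ
  exact ⟨by simpa using hlower μ hμ, hupper μ hμ⟩

theorem eventually_add_mul_notMem_spectrum (hB : Tendsto B l (𝓝 B₀)) {lam : ℂ}
    (hlam : lam ∉ spectrum ℂ B₀) {z : α → ℂ} (hz : Tendsto z l (𝓝 0)) (C : ℝ) :
    ∀ᶠ t in l, ∀ μ : ℂ, ‖μ‖ ≤ C → lam + z t * μ ∉ spectrum ℂ (B t) := by
  let _ : NormedRing (Matrix ι ι ℂ) := Matrix.linftyOpNormedRing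
  let _ : NormedAlgebra ℂ (Matrix ι ι ℂ) := Matrix.linftyOpNormedAlgebra
  obtain ⟨r, hr, hsep⟩ := exists_eventually_le_norm_sub_of_mem_spectrum hB hlam
  have hsmall : Tendsto (fun t => ‖z t‖ * C) l (𝓝 0) := by
    simpa using hz.norm.mul_const C
  filter_upwards [hsep, hsmall.eventually_lt_const hr] with t hsep hsmall μ hμ hmem
  have hle : r ≤ ‖z t‖ * ‖μ‖ := by simpa using hsep _ hmem
  exact absurd (hle.trans (mul_le_mul_of_nonneg_left hμ (norm_nonneg _))) (not_le.2 hsmall)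

end MatrixSpectrum

section InjectiveModRange

variable {𝕜 ι β : Type*} [Field 𝕜] [Fintype ι] [Fintype β]

/-- The matrix `M - ν` induces an injective map on the quotient by the range of `Z`. -/
def InjectiveModRange (M : Matrix ι ι 𝕜) (Z : Matrix ι β 𝕜) (ν : 𝕜) : Prop :=
  ∀ v a, M *ᵥ v - ν • v = Z *ᵥ a → ∃ b, v = Z *ᵥ b

variable {M : Matrix ι ι 𝕜} {Z : Matrix ι β 𝕜} {ν : 𝕜}

theorem InjectiveModRange.maxGenEigenspace_le [DecidableEq ι] [DecidableEq β]
    (h : InjectiveModRange M Z ν) :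
    Module.End.maxGenEigenspace (Matrix.toLin' M) ν ≤ LinearMap.range (Matrix.toLin' Z) :=
  JordanPert.maxGenEigenspace_le fun v ⟨a, ha⟩ =>
    let ⟨b, hb⟩ := h v a (by simpa using ha.symm)
    ⟨b, by simpa using hb.symm⟩

theorem InjectiveModRange.smul_one_add [DecidableEq ι] (h : InjectiveModRange M Z ν) (lam : 𝕜) :
    InjectiveModRange (lam • 1 + M) Z (lam + ν) := fun v a hv => h v a <| by
  rw [← hv, Matrix.add_mulVec, Matrix.smul_mulVec, Matrix.one_mulVec, add_smul]
  abel

section Unscaling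

variable {L B F : Matrix ι ι 𝕜} {K : Matrix β ι 𝕜} {J Y : Matrix ι β 𝕜} {Q : Matrix β β 𝕜} {z μ : 𝕜}

theorem mul_eq_smul_of_scaled [DecidableEq ι] (hL : IsUnit L)
    (hdef : z • (L * F) * Y * Q = L * B * F * Y) : B * (F * Y) = z • (F * Y * Q) := by
  have hcancel : L⁻¹ * L = 1 := Matrix.nonsing_inv_mul _ ((Matrix.isUnit_iff_isUnit_det _).1 hL)
  have := congrArg (L⁻¹ * ·) hdef
  simp only [Matrix.smul_mul, Matrix.mul_smul, ← Matrix.mul_assoc, hcancel, Matrix.one_mul] at this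
  rw [← Matrix.mul_assoc, ← this]

theorem injectiveModRange_of_scaled [DecidableEq ι] [DecidableEq β] (hF : IsUnit F) (hz : z ≠ 0)
    (hunit : IsUnit (quotientPencil K J (z • (L * F)) (L * B * F) Y μ)) (hU : K * z • (L * F) = K)
    (hY : K * Y = 1) (hdef : z • (L * F) * Y * Q = L * B * F * Y) :
    InjectiveModRange B (F * Y) (z * μ) := by
  intro v a hv
  have hcancel : F *ᵥ (F⁻¹ *ᵥ v) = v := by
    rw [Matrix.mulVec_mulVec, Matrix.mul_nonsing_inv _ ((Matrix.isUnit_iff_isUnit_det _).1 hF),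
      Matrix.one_mulVec]
  have hscaled : (L * B * F) *ᵥ (F⁻¹ *ᵥ v) - μ • (z • (L * F)) *ᵥ (F⁻¹ *ᵥ v) =
      (z • (L * F) * Y) *ᵥ (z⁻¹ • a) := by
    simp only [Matrix.smul_mul, Matrix.smul_mulVec, Matrix.mulVec_smul,
      ← Matrix.mulVec_mulVec, hcancel]
    rw [Matrix.mulVec_mulVec _ F Y, ← hv, Matrix.mulVec_sub, Matrix.mulVec_smul, smul_smul,
      inv_smul_smul₀ hz, mul_comm z]
  obtain ⟨b, hb⟩ := exists_eq_mulVec_of_isUnit_quotientPencil hunit hU hY hdef hscaled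
  exact ⟨b, by rw [← hcancel, hb, Matrix.mulVec_mulVec]⟩

end Unscaling

section BlockTriangular

variable {κ : Type*} [Fintype κ] [DecidableEq ι] [DecidableEq κ]

/-- In the basis `[Φ Φc]`, whose inverse has the block rows `S` and `T`, the matrix `M` is block
upper triangular with diagonal blocks `B`, `Bc` and off-diagonal block `C`. -/
structure IsBlockTriangularization {n : Type*} [Fintype n] [DecidableEq n] (M : Matrix n n 𝕜)
    (Φ : Matrix n ι 𝕜) (Φc : Matrix n κ 𝕜) (S : Matrix ι n 𝕜) (T : Matrix κ n 𝕜)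
    (B : Matrix ι ι 𝕜) (C : Matrix ι κ 𝕜) (Bc : Matrix κ κ 𝕜) : Prop where
  mul_add_mul : Φ * S + Φc * T = 1
  S_mul : S * Φ = 1
  S_mul_compl : S * Φc = 0
  T_mul : T * Φ = 0
  T_mul_compl : T * Φc = 1
  map : M * Φ = Φ * B
  map_compl : M * Φc = Φ * C + Φc * Bc

variable {n : Type*} [Fintype n] [DecidableEq n] {M : Matrix n n 𝕜} {Φ : Matrix n ι 𝕜}
  {Φc : Matrix n κ 𝕜} {S : Matrix ι n 𝕜} {T : Matrix κ n 𝕜} {B : Matrix ι ι 𝕜} {C : Matrix ι κ 𝕜}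
  {Bc : Matrix κ κ 𝕜}

namespace IsBlockTriangularization

theorem of_fromCols (hleft : Matrix.fromRows S T * Matrix.fromCols Φ Φc = 1)
    (hright : Matrix.fromCols Φ Φc * Matrix.fromRows S T = 1)
    (hM : M * Matrix.fromCols Φ Φc = Matrix.fromCols Φ Φc * Matrix.fromBlocks B C 0 Bc) :
    IsBlockTriangularization M Φ Φc S T B C Bc := by
  rw [Matrix.fromRows_mul_fromCols, ← Matrix.fromBlocks_one, Matrix.fromBlocks_inj] at hleft
  rw [Matrix.fromCols_mul_fromRows] at hright
  rw [Matrix.mul_fromCols, Matrix.fromCols_mul_fromBlocks, Matrix.mul_zero, add_zero] at hM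
  obtain ⟨hSΦ, hSΦc, hTΦ, hTΦc⟩ := hleft
  exact ⟨hright, hSΦ, hSΦc, hTΦ, hTΦc, (Matrix.fromCols_inj hM).1, (Matrix.fromCols_inj hM).2⟩

theorem injectiveModRange (h : IsBlockTriangularization M Φ Φc S T B C Bc)
    (hBc : ν ∉ spectrum 𝕜 Bc) (hB : InjectiveModRange B Z ν) : InjectiveModRange M (Φ * Z) ν := by
  intro v a hv
  obtain ⟨w, u, rfl⟩ : ∃ w u, v = Φ *ᵥ w + Φc *ᵥ u := ⟨S *ᵥ v, T *ᵥ v, by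
    rw [Matrix.mulVec_mulVec, Matrix.mulVec_mulVec, ← Matrix.add_mulVec, h.mul_add_mul,
      Matrix.one_mulVec]⟩
  have hblocks : Φ *ᵥ (B *ᵥ w - ν • w + C *ᵥ u) + Φc *ᵥ (Bc *ᵥ u - ν • u) = Φ *ᵥ (Z *ᵥ a) := by
    rw [Matrix.mulVec_mulVec, ← hv]
    simp only [Matrix.mulVec_add, Matrix.mulVec_mulVec, h.map, h.map_compl, Matrix.mulVec_sub,
      Matrix.mulVec_smul, Matrix.add_mulVec, smul_add]
    abel
  have hu : u = 0 := by
    have hTrow : Bc *ᵥ u = ν • u := by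
      simpa [Matrix.mulVec_add, Matrix.mulVec_mulVec, ← Matrix.mul_assoc, h.T_mul, h.T_mul_compl,
        sub_eq_zero] using congrArg (T *ᵥ ·) hblocks
    refine Matrix.mulVec_injective_of_isUnit (spectrum.notMem_iff.1 hBc) ?_
    simp [Matrix.sub_mulVec, Algebra.algebraMap_eq_smul_one, Matrix.smul_mulVec, hTrow]
  subst hu
  obtain ⟨b, rfl⟩ := hB w a (by
    simpa [Matrix.mulVec_add, Matrix.mulVec_mulVec, ← Matrix.mul_assoc, h.S_mul]
      using congrArg (S *ᵥ ·) hblocks)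
  exact ⟨b, by simp⟩

theorem mul_eq (h : IsBlockTriangularization M Φ Φc S T B C Bc) {γ : Type*} (D : Matrix n n 𝕜)
    (Q : Matrix n γ 𝕜) : D * Q = Φ * (S * D * Q) + Φc * (T * D * Q) := by
  rw [Matrix.mul_assoc S, Matrix.mul_assoc T, ← Matrix.mul_assoc Φ, ← Matrix.mul_assoc Φc,
    ← Matrix.add_mul, h.mul_add_mul, Matrix.one_mul]

theorem add_smul_of_riccati (h : IsBlockTriangularization M Φ Φc S T B 0 Bc) {D : Matrix n n 𝕜}
    {t : 𝕜} {P : Matrix κ ι 𝕜}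
    (hP : (Bc + t • (T * D * Φc)) * P - P * (B + t • (S * D * Φ)) - t • (P * (S * D * Φc) * P)
      + t • (T * D * Φ) = 0) :
    IsBlockTriangularization (M + t • D) (Φ + Φc * P) Φc S (T - P * S)
      (B + t • (S * D * Φ + S * D * Φc * P)) (t • (S * D * Φc))
      (Bc + t • (T * D * Φc - P * (S * D * Φc))) where
  mul_add_mul := by
    rw [← h.mul_add_mul, Matrix.add_mul, Matrix.mul_sub, Matrix.mul_assoc]
    abel
  S_mul := by rw [Matrix.mul_add, ← Matrix.mul_assoc, h.S_mul, h.S_mul_compl]; simp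
  S_mul_compl := h.S_mul_compl
  T_mul := by
    simp [Matrix.sub_mul, Matrix.mul_add, ← Matrix.mul_assoc, Matrix.mul_assoc P, h.S_mul,
      h.S_mul_compl, h.T_mul, h.T_mul_compl]
  T_mul_compl := by simp [Matrix.sub_mul, Matrix.mul_assoc, h.S_mul_compl, h.T_mul_compl]
  map := by
    rw [← sub_eq_zero, ← Matrix.mul_zero Φc, ← hP, Matrix.add_mul, Matrix.mul_add M,
      ← Matrix.mul_assoc M, h.map, h.map_compl, Matrix.smul_mul, Matrix.mul_add D,
      ← Matrix.mul_assoc D, h.mul_eq D Φ, h.mul_eq D Φc]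
    simp only [Matrix.add_mul, Matrix.mul_add, Matrix.mul_sub, Matrix.smul_mul, Matrix.mul_smul,
      smul_add, Matrix.mul_assoc, Matrix.mul_zero, zero_add]
    abel
  map_compl := by
    rw [Matrix.add_mul, Matrix.smul_mul, h.mul_eq D Φc, h.map_compl]
    simp only [Matrix.add_mul, Matrix.mul_add, Matrix.mul_sub, Matrix.mul_smul, smul_add, smul_sub,
      Matrix.mul_assoc, Matrix.mul_zero, zero_add]
    abel

end IsBlockTriangularization

end BlockTriangular

end InjectiveModRange

section SpectralSubspace

variable {n : ℕ} {β : Type*} [Fintype β] [DecidableEq β] {M : Matrix (Fin n) (Fin n) ℂ}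
  {X : Matrix (Fin n) β ℂ} {lam : ℂ} {z c C : ℝ}

theorem range_le_spectralSubspace {Q : Matrix β β ℂ} (hz : 0 ≤ z)
    (hX : M * X = X * (lam • 1 + (z : ℂ) • Q)) (hQ : ∀ μ ∈ spectrum ℂ Q, c ≤ ‖μ‖ ∧ ‖μ‖ ≤ C) :
    LinearMap.range (Matrix.toLin' X) ≤ spectralSubspace M lam (c * z) (C * z) := by
  have hfg : ∀ x, Matrix.toLin' M (Matrix.toLin' X x) =
      lam • Matrix.toLin' X x + (z : ℂ) • Matrix.toLin' X (Matrix.toLin' Q x) := fun x => by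
    simp only [Matrix.toLin'_apply, Matrix.mulVec_mulVec, hX, Matrix.mul_add, Matrix.add_mulVec,
      Matrix.mul_smul, Matrix.mul_one, Matrix.smul_mulVec]
  rw [LinearMap.range_eq_map, ← iSup_spectrum_maxGenEigenspace_eq_top (Matrix.toLin' Q)]
  simp only [Submodule.map_iSup, iSup_le_iff]
  intro μ hμ
  obtain ⟨hcμ, hμC⟩ := hQ μ (by simpa [Matrix.spectrum_toLin'] using hμ)
  refine (map_maxGenEigenspace_le hfg μ).trans (le_iSup₂_of_le (lam + z * μ) ?_ le_rfl)
  simp only [Set.mem_ofPred_eq, add_sub_cancel_left, norm_mul, Complex.norm_real,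
    Real.norm_of_nonneg hz, mul_comm _ z]
  exact ⟨by gcongr, by gcongr⟩

theorem spectralSubspace_le_range (hz : 0 < z)
    (h : ∀ μ : ℂ, c ≤ ‖μ‖ → ‖μ‖ ≤ C → InjectiveModRange M X (lam + z * μ)) :
    spectralSubspace M lam (c * z) (C * z) ≤ LinearMap.range (Matrix.toLin' X) := by
  refine iSup₂_le fun ν hν => InjectiveModRange.maxGenEigenspace_le ?_
  have hz' : (z : ℂ) ≠ 0 := Complex.ofReal_ne_zero.2 hz.ne'
  have hnorm : ‖(ν - lam) / z‖ = ‖ν - lam‖ / z := by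
    rw [norm_div, Complex.norm_real, Real.norm_of_nonneg hz.le]
  simpa [mul_div_cancel₀ _ hz'] using h ((ν - lam) / z) (by rw [hnorm, le_div_iff₀ hz]; exact hν.1)
    (by rw [hnorm, div_le_iff₀ hz]; exact hν.2)

end SpectralSubspace

section Rows

variable {𝕜 α β γ : Type*} [NonAssocSemiring 𝕜] [Fintype β] {M : Matrix α β 𝕜} {p : α}

theorem mulVec_apply_of_row_eq_zero (h : M p = 0) (v : β → 𝕜) : (M *ᵥ v) p = 0 := by
  rw [Matrix.mulVec, h, zero_dotProduct]

theorem mul_apply_of_row_eq_zero (h : M p = 0) (B : Matrix β γ 𝕜) (y : γ) : (M * B) p y = 0 :=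
  mulVec_apply_of_row_eq_zero h (B.col y)

variable [DecidableEq β] {q : β}

theorem mulVec_apply_of_row_eq_single (h : M p = Pi.single q 1) (v : β → 𝕜) :
    (M *ᵥ v) p = v q := by
  rw [Matrix.mulVec, h, single_one_dotProduct]

theorem mul_apply_of_row_eq_single (h : M p = Pi.single q 1) (B : Matrix β γ 𝕜) (y : γ) :
    (M * B) p y = B q y :=
  mulVec_apply_of_row_eq_single h (B.col y)

end Rows

theorem linearIndependent_col_of_mul_eq_one {𝕜 ι β : Type*} [CommRing 𝕜] [Fintype ι] [Finite β]
    [DecidableEq β] {A : Matrix β ι 𝕜} {B : Matrix ι β 𝕜} (h : A * B = 1) :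
    LinearIndependent 𝕜 B.col := by
  have := Fintype.ofFinite β
  refine Matrix.mulVec_injective_iff.1 <| Function.LeftInverse.injective (g := A.mulVec) fun v => ?_
  rw [Matrix.mulVec_mulVec, h, Matrix.one_mulVec]

theorem eq_of_mem_spectrum_smul_one_add {𝕜 A : Type*} [Field 𝕜] [Ring A] [Algebra 𝕜 A] {a : A}
    (ha : IsNilpotent a) {lam μ : 𝕜} (hμ : μ ∈ spectrum 𝕜 (lam • 1 + a)) : μ = lam := by
  by_contra hne
  refine hμ ?_
  rw [spectrum.mem_resolventSet_iff, ← Algebra.algebraMap_eq_smul_one, ← sub_sub, ← map_sub,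
    sub_eq_add_neg]
  exact ha.neg.isUnit_add_left_of_commute ((isUnit_iff_ne_zero.2 (sub_ne_zero.2 hne)).map _)
    (Algebra.commutes _ _).symm

section JordanStructure

variable {k : ℕ} {s : ℕ → ℕ}

theorem Size.one_le (i : Size k) : 1 ≤ i.1 := (Finset.mem_Icc.1 i.2).1

theorem fst_val (i : Size k) : (fst i : ℕ) = 0 := rfl

theorem lst_val (i : Size k) : (lst i : ℕ) = i.1 - 1 := rfl

theorem eq_fst_iff {i : Size k} {l : Fin i.1} : l = fst i ↔ (l : ℕ) = 0 := by
  rw [Fin.ext_iff, fst_val]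

theorem eq_lst_iff {i : Size k} {l : Fin i.1} : l = lst i ↔ (l : ℕ) + 1 = i.1 := by
  have := i.one_le
  rw [Fin.ext_iff, lst_val]
  omega

theorem N_apply_of_lt {i : Size k} {l : Fin i.1} (h : (l : ℕ) + 1 < i.1) (a : Fin (s i.1)) :
    N k s ⟨i, l, a⟩ = Pi.single ⟨i, ⟨l + 1, h⟩, a⟩ 1 := by
  ext ⟨j, l', a'⟩
  rcases eq_or_ne i j with rfl | hne
  · simp [N, Pi.single_apply, Fin.ext_iff, eq_comm]
  · simp [N, hne, hne.symm]

theorem N_apply_of_not_lt {i : Size k} {l : Fin i.1} (h : ¬ (l : ℕ) + 1 < i.1)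
    (a : Fin (s i.1)) : N k s ⟨i, l, a⟩ = 0 := by
  ext ⟨j, l', a'⟩
  have : ¬ (i = j ∧ (l : ℕ) + 1 = l' ∧ (a : ℕ) = a') := by
    rintro ⟨rfl, hl, -⟩
    exact h (hl ▸ l'.2)
  simp [N, this]

theorem N_pow_apply_eq_zero {d : ℕ} {p : JIdx k s} (h : p.1.1 ≤ (p.2.1 : ℕ) + d) :
    (N k s ^ d) p = 0 := by
  induction d generalizing p with
  | zero => exact absurd h (by simp)
  | succ d ih =>
    obtain ⟨i, l, a⟩ := p
    ext q
    rw [pow_succ']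
    by_cases hl : (l : ℕ) + 1 < i.1
    · rw [mul_apply_of_row_eq_single (N_apply_of_lt hl a), ih (by simp only at h ⊢; omega)]
    · exact mul_apply_of_row_eq_zero (N_apply_of_not_lt hl a) _ q

theorem isNilpotent_N : IsNilpotent (N k s) :=
  ⟨k, funext fun p => N_pow_apply_eq_zero
    ((Finset.mem_Icc.1 p.1.2).2.trans (Nat.le_add_left k p.2.1))⟩

/-- The inclusion of the coordinates that belong to the size `ρ`; multiplication by its transpose
selects the corresponding rows. -/
def blockIncl (s : ℕ → ℕ) (ρ : Size k) : Matrix (JIdx k s) (Blk s ρ) ℂ :=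
  (1 : Matrix (JIdx k s) (JIdx k s) ℂ).submatrix id (Sigma.mk ρ)

theorem blockIncl_apply_self (ρ : Size k) (x : Blk s ρ) :
    blockIncl s ρ ⟨ρ, x⟩ = Pi.single x 1 := by
  ext y
  simp [blockIncl, Matrix.one_apply, Pi.single_apply, eq_comm]

theorem blockIncl_apply_of_ne {ρ : Size k} {p : JIdx k s} (h : p.1 ≠ ρ) :
    blockIncl s ρ p = 0 := by
  ext y
  exact Matrix.one_apply_ne fun hp => h (congrArg Sigma.fst hp)

variable {α : Type*}

theorem mul_blockIncl_apply (ρ : Size k) (M : Matrix α (JIdx k s) ℂ) (x : α) (y : Blk s ρ) :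
    (M * blockIncl s ρ) x y = M x ⟨ρ, y⟩ := by
  simp [blockIncl, Matrix.mul_apply, Matrix.one_apply]

theorem blockIncl_transpose_mul_apply (ρ : Size k) (M : Matrix (JIdx k s) α ℂ) (x : Blk s ρ)
    (y : α) : ((blockIncl s ρ)ᵀ * M) x y = M ⟨ρ, x⟩ y := by
  simp [blockIncl, Matrix.mul_apply, Matrix.one_apply]

theorem blockIncl_transpose_mulVec_apply (ρ : Size k) (v : JIdx k s → ℂ) (x : Blk s ρ) :
    ((blockIncl s ρ)ᵀ *ᵥ v) x = v ⟨ρ, x⟩ :=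
  blockIncl_transpose_mul_apply ρ (Matrix.of fun p _ => v p) x ()

theorem blockIncl_transpose_mul_self (ρ : Size k) : (blockIncl s ρ)ᵀ * blockIncl s ρ = 1 := by
  ext x y
  rw [blockIncl_transpose_mul_apply, blockIncl_apply_self, Matrix.one_eq_pi_single]

theorem isUnit_L (ρ : Size k) {z : ℂ} (hz : z ≠ 0) : IsUnit (L s ρ z) := by
  rw [L, Matrix.isUnit_diagonal, Pi.isUnit_iff]
  exact fun p => (inv_ne_zero (pow_ne_zero _ hz)).isUnit

theorem isUnit_R (ρ : Size k) {z : ℂ} (hz : z ≠ 0) : IsUnit (R s ρ z) := by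
  rw [R, Matrix.isUnit_diagonal, Pi.isUnit_iff]
  exact fun p => (pow_ne_zero _ hz).isUnit

theorem L_mul_N_mul_R (ρ : Size k) {z : ℂ} (hz : z ≠ 0) : L s ρ z * N k s * R s ρ z = N k s := by
  ext p q
  rw [L, R, Matrix.mul_diagonal, Matrix.diagonal_mul]
  by_cases h : p.1 = q.1 ∧ (p.2.1 : ℕ) + 1 = q.2.1 ∧ (p.2.2 : ℕ) = q.2.2
  · rw [← h.2.1, ← h.1]
    simp [N, h, hz]
  · simp [N, h]

end JordanStructure

section Tail

variable {n k : ℕ} {s : ℕ → ℕ}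

theorem sum_eq_sum_tail {i : ℕ} (f : JIdx k s → ℂ)
    (h : ∀ p : JIdx k s, ¬ (i ≤ p.1.1 ∧ (p.2.1 : ℕ) = 0) → f p = 0) :
    ∑ p, f p = ∑ p : Tail k s i, f ⟨p.1.1, fst p.1.1, p.1.2⟩ := by
  symm
  refine Fintype.sum_of_injective (fun p : Tail k s i => (⟨p.1.1, fst p.1.1, p.1.2⟩ : JIdx k s))
    ?_ _ _ ?_ fun _ => rfl
  · rintro ⟨⟨j, b⟩, hj⟩ ⟨⟨j', b'⟩, hj'⟩ h
    simp only [Sigma.mk.injEq] at h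
    obtain ⟨rfl, h⟩ := h
    simp at h
    simp [h]
  · rintro ⟨j, l, b⟩ hp
    refine h _ fun h' => hp ⟨⟨⟨j, b⟩, h'.1⟩, ?_⟩
    obtain rfl : l = fst j := eq_fst_iff.2 h'.2
    rfl

/-- Splits the index set of `[Ξ_{ρ,1}, …, Ξ_{k,1}]` into those of `Ξ_{ρ,1}` and of
`[Ξ_{ρ+1,1}, …, Ξ_{k,1}]`. -/
noncomputable def tailEquiv (s : ℕ → ℕ) (ρ : Size k) :
    Fin (s ρ.1) ⊕ Tail k s (ρ.1 + 1) ≃ Tail k s ρ.1 :=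
  Equiv.ofBijective
    (Sum.elim (fun b => ⟨⟨ρ, b⟩, le_rfl⟩) fun p => ⟨p.1, (Nat.le_succ _).trans p.2⟩) <| by
    constructor
    · refine Function.Injective.sumElim ?_ ?_ ?_
      · intro b b' h
        simpa using h
      · intro p p' h
        simpa [Subtype.ext_iff] using h
      · rintro b ⟨p, hp⟩ h
        obtain rfl : ⟨ρ, b⟩ = p := congrArg Subtype.val h
        exact absurd hp (by simp)
    · rintro ⟨⟨j, b⟩, h⟩
      rcases Nat.lt_or_ge ρ.1 j.1 with hlt | hge
      · exact ⟨Sum.inr ⟨⟨j, b⟩, hlt⟩, rfl⟩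
      · obtain rfl : j = ρ := Subtype.ext (le_antisymm hge h)
        exact ⟨Sum.inl b, rfl⟩

theorem tailEquiv_inl (ρ : Size k) (b : Fin (s ρ.1)) :
    tailEquiv s ρ (Sum.inl b) = ⟨⟨ρ, b⟩, le_rfl⟩ := rfl

theorem tailEquiv_inr (ρ : Size k) (p : Tail k s (ρ.1 + 1)) :
    tailEquiv s ρ (Sum.inr p) = ⟨p.1, (Nat.le_succ _).trans p.2⟩ := rfl

variable (D : Matrix (Fin n) (Fin n) ℂ) (Ξ Sg : Matrix (Fin n) (JIdx k s) ℂ) (ρ : Size k)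

/-- `Ξ_{ρ,1} + [Ξ_{ρ+1,1}, …, Ξ_{k,1}] G_ρ^{(ρ)}`, the nonzero block of the leading term of the
basis matrix `X`. -/
noncomputable def leadCol : Matrix (Fin n) (Fin (s ρ.1)) ℂ :=
  firstCol Ξ ρ + tailFirst Ξ (ρ.1 + 1) * Gblk D Ξ Sg ρ ρ

theorem tailFirst_mul_lead_apply (r : Fin n) (y : Blk s ρ) :
    (tailFirst Ξ ρ.1 * lead D Ξ Sg ρ) r y =
      if y.1 = fst ρ then leadCol D Ξ Sg ρ r y.2 else 0 := by
  rw [Matrix.mul_apply, ← (tailEquiv s ρ).sum_comp, Fintype.sum_sum_type]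
  split_ifs with hy
  · rw [leadCol, Matrix.add_apply, Matrix.mul_apply]
    congr 1
    · simp [tailEquiv_inl, lead, hy, tailFirst, firstCol, ← Fin.ext_iff]
    · refine Finset.sum_congr rfl fun p _ => ?_
      rw [tailEquiv_inr, lead, if_pos hy, dif_pos p.2]
      rfl
  · simp [lead, hy]

theorem lastCol_mul_leadCol : (lastCol Sg ρ)ᴴ * D * leadCol D Ξ Sg ρ = S D Ξ Sg ρ := by
  rw [leadCol, S, Matrix.mul_add, Matrix.mul_assoc _ (tailFirst Ξ _)]

variable {D Ξ Sg ρ}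

theorem tailLast_mul_leadCol (hW : IsUnit (W D Ξ Sg (ρ.1 + 1))) :
    (tailLast Sg (ρ.1 + 1))ᴴ * D * leadCol D Ξ Sg ρ = 0 := by
  rw [leadCol, Matrix.mul_add, ← Matrix.mul_assoc, ← W, Gblk, Matrix.mul_neg,
    Matrix.mul_nonsing_inv_cancel_left _ _ ((Matrix.isUnit_iff_isUnit_det _).1 hW), add_neg_cancel]

theorem isUnit_S (hW : IsUnit (W D Ξ Sg ρ.1)) (hW' : IsUnit (W D Ξ Sg (ρ.1 + 1))) :
    IsUnit (S D Ξ Sg ρ) := by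
  have := hW'.invertible
  have hblocks : (W D Ξ Sg ρ.1).submatrix (tailEquiv s ρ) (tailEquiv s ρ) =
      Matrix.fromBlocks ((lastCol Sg ρ)ᴴ * D * firstCol Ξ ρ)
        ((lastCol Sg ρ)ᴴ * D * tailFirst Ξ (ρ.1 + 1))
        ((tailLast Sg (ρ.1 + 1))ᴴ * D * firstCol Ξ ρ) (W D Ξ Sg (ρ.1 + 1)) := by
    ext (a | a) (b | b) <;> rfl
  rw [← Matrix.isUnit_submatrix_equiv (tailEquiv s ρ) (tailEquiv s ρ), hblocks,
    Matrix.isUnit_fromBlocks_iff_of_invertible₂₂] at hW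
  rwa [S, Gblk, Matrix.mul_neg, ← sub_eq_add_neg, ← Matrix.invOf_eq_nonsing_inv,
    ← Matrix.mul_assoc]

theorem Theta_apply_of_lt {l : Fin ρ.1} (h : (l : ℕ) + 1 < ρ.1) (a : Fin (s ρ.1)) :
    Theta D Ξ Sg ρ (l, a) = Pi.single (⟨l + 1, h⟩, a) 1 := by
  have hl : l ≠ lst ρ := fun h' => by rw [eq_lst_iff] at h'; omega
  ext y
  simp [Theta, hl, Pi.single_apply, Prod.ext_iff, Fin.ext_iff, eq_comm]

theorem Theta_apply_lst (a : Fin (s ρ.1)) (y : Blk s ρ) :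
    Theta D Ξ Sg ρ (lst ρ, a) y = if y.1 = fst ρ then S D Ξ Sg ρ a y.2 else 0 := by
  have hne : (lst ρ : ℕ) + 1 ≠ y.1 := by have := y.1.2; rw [lst_val]; omega
  simp [Theta, hne]

theorem Theta_mulVec_apply_lst (a : Fin (s ρ.1)) (v : Blk s ρ → ℂ) :
    (Theta D Ξ Sg ρ *ᵥ v) (lst ρ, a) = (S D Ξ Sg ρ *ᵥ fun b => v (fst ρ, b)) a := by
  simp only [Matrix.mulVec, dotProduct, Theta_apply_lst, Fintype.sum_prod_type]
  rw [Finset.sum_eq_single (fst ρ)] <;> simp +contextual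

theorem isUnit_Theta (hS : IsUnit (S D Ξ Sg ρ)) : IsUnit (Theta D Ξ Sg ρ) := by
  rw [← Matrix.mulVec_injective_iff_isUnit, ← Matrix.coe_mulVecLin, injective_iff_map_eq_zero]
  intro v hv
  have hfst : (fun b => v (fst ρ, b)) = 0 := by
    refine Matrix.mulVec_injective_of_isUnit hS (funext fun a => ?_)
    rw [← Theta_mulVec_apply_lst, Matrix.mulVec_zero]
    exact congrFun hv (lst ρ, a)
  ext ⟨⟨l, hl⟩, a⟩
  cases l with
  | zero => exact congrFun hfst a
  | succ l =>
    exact (mulVec_apply_of_row_eq_single (Theta_apply_of_lt (l := ⟨l, by omega⟩) hl a) v).symm.trans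
      (congrFun hv _)

end Tail

section Elimination

variable {n k : ℕ} {s : ℕ → ℕ}
variable (D : Matrix (Fin n) (Fin n) ℂ) (Ξ Sg : Matrix (Fin n) (JIdx k s) ℂ) (ρ : Size k)

theorem G_apply_eq_one_apply {p q : JIdx k s}
    (h : ¬ (ρ.1 < p.1.1 ∧ (p.2.1 : ℕ) = 0 ∧ q.1.1 ≤ ρ.1)) :
    G D Ξ Sg ρ p q = (1 : Matrix _ _ ℂ) p q := by
  have h' : ¬ (ρ.1 + 1 ≤ p.1.1 ∧ p.2.1 = fst p.1 ∧ q.1.1 ≤ ρ.1 ∧ q.2.1 = fst q.1) :=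
    fun ⟨h1, h2, h3, _⟩ => h ⟨h1, eq_fst_iff.1 h2, h3⟩
  rw [G, dif_neg h', add_zero, Matrix.one_apply]

theorem G_apply_of_not {p : JIdx k s} (h : ¬ (ρ.1 < p.1.1 ∧ (p.2.1 : ℕ) = 0)) :
    G D Ξ Sg ρ p = Pi.single p 1 := by
  ext q
  rw [G_apply_eq_one_apply D Ξ Sg ρ fun h' => h ⟨h'.1, h'.2.1⟩, Matrix.one_eq_pi_single]

theorem G_mulVec_eq_self {v : JIdx k s → ℂ} (h : ∀ p : JIdx k s, p.1.1 ≤ ρ.1 → v p = 0) :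
    G D Ξ Sg ρ *ᵥ v = v := by
  ext p
  conv_rhs => rw [← Matrix.one_mulVec v]
  refine Finset.sum_congr rfl fun q _ => ?_
  by_cases hq : q.1.1 ≤ ρ.1
  · rw [h q hq, mul_zero, mul_zero]
  · exact congrArg (· * v q) (G_apply_eq_one_apply D Ξ Sg ρ fun h' => hq h'.2.2)

theorem isUnit_G : IsUnit (G D Ξ Sg ρ) := by
  have hsq : (G D Ξ Sg ρ - 1) ^ 2 = 0 := by
    ext p q
    rw [pow_two, Matrix.mul_apply]
    refine Finset.sum_eq_zero fun r _ => ?_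
    simp only [Matrix.sub_apply]
    by_cases hr : r.1.1 ≤ ρ.1
    · rw [G_apply_eq_one_apply D Ξ Sg ρ (p := r) fun h => hr.not_gt h.1, sub_self, mul_zero]
    · rw [G_apply_eq_one_apply D Ξ Sg ρ (q := r) fun h => hr h.2.2, sub_self, zero_mul]
  simpa using IsNilpotent.isUnit_add_one ⟨2, hsq⟩

theorem N_mul_G : N k s * G D Ξ Sg ρ = N k s := by
  ext ⟨i, l, a⟩ q
  by_cases h : (l : ℕ) + 1 < i.1
  · rw [mul_apply_of_row_eq_single (N_apply_of_lt h a), N_apply_of_lt h a,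
      G_apply_of_not D Ξ Sg ρ (by simp)]
  · rw [mul_apply_of_row_eq_zero (N_apply_of_not_lt h a), N_apply_of_not_lt h a, Pi.zero_apply]

end Elimination

section ScaledPencil

attribute [local instance] Matrix.normedAddCommGroup Matrix.normedSpace

variable {n k : ℕ} {s : ℕ → ℕ}
variable (D : Matrix (Fin n) (Fin n) ℂ) (Ξ Sg : Matrix (Fin n) (JIdx k s) ℂ) (ρ : Size k)

/-- `Û(z)` with the negative powers of `z` cancelled, so that it extends to `z = 0`. -/
noncomputable def Upoly (z : ℂ) : Matrix (JIdx k s) (JIdx k s) ℂ :=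
  Matrix.diagonal (fun p : JIdx k s => if (p.2.1 : ℕ) + ρ.1 < p.1.1 then z else 1) * G D Ξ Sg ρ

/-- `V̂(z)` with the negative powers of `z` cancelled, so that it extends to `z = 0`. -/
noncomputable def Vpoly (z : ℂ) (E : Matrix (JIdx k s) (JIdx k s) ℂ) :
    Matrix (JIdx k s) (JIdx k s) ℂ :=
  N k s +
    Matrix.diagonal (fun p : JIdx k s => z ^ (ρ.1 - (((p.2.1 : ℕ) + 1) - (p.1.1 - ρ.1)))) *
      E * (R s ρ z * G D Ξ Sg ρ)

theorem Uhat_eq_Upoly {z : ℂ} (hz : z ≠ 0) : Uhat D Ξ Sg ρ z = Upoly D Ξ Sg ρ z := by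
  unfold Uhat Upoly
  congr 1
  rw [L, R, mul_smul_comm, mul_one, smul_mul_assoc, Matrix.diagonal_mul_diagonal,
    ← Matrix.diagonal_smul]
  congr 1
  ext p
  simp only [Pi.smul_apply, smul_eq_mul]
  split_ifs with h
  · rw [show (p.2.1 : ℕ) + 1 - (p.1.1 - ρ.1) = 0 by omega,
      show (p.2.1 : ℕ) - (p.1.1 - ρ.1) = 0 by omega]
    simp
  · rw [show (p.2.1 : ℕ) + 1 - (p.1.1 - ρ.1) = (p.2.1 : ℕ) - (p.1.1 - ρ.1) + 1 by omega, pow_succ]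
    field_simp

theorem Vhat_eq_Vpoly {z : ℂ} (hz : z ≠ 0) (E : Matrix (JIdx k s) (JIdx k s) ℂ) :
    Vhat D Ξ Sg E ρ z = Vpoly D Ξ Sg ρ z E := by
  have hL : z ^ ρ.1 • L s ρ z =
      Matrix.diagonal fun p => z ^ (ρ.1 - (((p.2.1 : ℕ) + 1) - (p.1.1 - ρ.1))) := by
    rw [L, ← Matrix.diagonal_smul]
    congr 1
    ext p
    have hle : (p.2.1 : ℕ) + 1 - (p.1.1 - ρ.1) ≤ ρ.1 := by have := p.2.1.2; omega
    rw [Pi.smul_apply, smul_eq_mul, pow_sub₀ _ hz hle]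
  rw [Vhat, Vpoly, mul_add, add_mul, L_mul_N_mul_R ρ hz, mul_smul_comm, ← smul_mul_assoc, hL,
    add_mul, N_mul_G, mul_assoc _ (R s ρ z)]

theorem contDiff_Upoly {E : Type*} [NormedAddCommGroup E] [NormedSpace ℂ E] {z : E → ℂ}
    (hz : ContDiff ℂ 1 z) : ContDiff ℂ 1 fun p => Upoly D Ξ Sg ρ (z p) := by
  refine contDiff_matrix_mul (contDiff_matrix_diagonal fun p => ?_) contDiff_const
  split_ifs
  · exact hz
  · exact contDiff_const

theorem contDiff_Vpoly {E : Type*} [NormedAddCommGroup E] [NormedSpace ℂ E] {z : E → ℂ}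
    {F : E → Matrix (JIdx k s) (JIdx k s) ℂ} (hz : ContDiff ℂ 1 z) (hF : ContDiff ℂ 1 F) :
    ContDiff ℂ 1 fun p => Vpoly D Ξ Sg ρ (z p) (F p) :=
  contDiff_const.add <| contDiff_matrix_mul
    (contDiff_matrix_mul (contDiff_matrix_diagonal fun _ => hz.pow _) hF)
    (contDiff_matrix_mul (contDiff_matrix_diagonal fun _ => hz.pow _) contDiff_const)

theorem Upoly_apply_of_not (z : ℂ) {p : JIdx k s} (h : ¬ (p.2.1 : ℕ) + ρ.1 < p.1.1) :
    Upoly D Ξ Sg ρ z p = Pi.single p 1 := by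
  ext q
  rw [Upoly, Matrix.diagonal_mul, if_neg h, one_mul, G_apply_of_not]
  omega

theorem Upoly_zero_apply_of_lt {p : JIdx k s} (h : (p.2.1 : ℕ) + ρ.1 < p.1.1) :
    Upoly D Ξ Sg ρ 0 p = 0 := by
  ext q
  rw [Upoly, Matrix.diagonal_mul, if_pos h, zero_mul, Pi.zero_apply]

theorem blockIncl_transpose_mul_Upoly (z : ℂ) :
    (blockIncl s ρ)ᵀ * Upoly D Ξ Sg ρ z = (blockIncl s ρ)ᵀ := by
  ext x q
  rw [blockIncl_transpose_mul_apply, Upoly_apply_of_not D Ξ Sg ρ z (by simp)]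
  simp [blockIncl, Matrix.one_apply, Pi.single_apply]

theorem Upoly_zero_mul_blockIncl : Upoly D Ξ Sg ρ 0 * blockIncl s ρ = blockIncl s ρ := by
  ext p y
  by_cases h : (p.2.1 : ℕ) + ρ.1 < p.1.1
  · rw [mul_apply_of_row_eq_zero (Upoly_zero_apply_of_lt D Ξ Sg ρ h), blockIncl_apply_of_ne,
      Pi.zero_apply]
    rintro rfl
    omega
  · exact mul_apply_of_row_eq_single (Upoly_apply_of_not D Ξ Sg ρ 0 h) _ y

theorem Vpoly_zero_apply_of_not (E : Matrix (JIdx k s) (JIdx k s) ℂ) {p : JIdx k s}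
    (hp : p.1.1 < ρ.1 ∨ (p.2.1 : ℕ) + 1 < p.1.1) : Vpoly D Ξ Sg ρ 0 E p = N k s p := by
  have := p.2.1.2
  have := ρ.one_le
  ext q
  rw [Vpoly, Matrix.add_apply, mul_assoc, Matrix.diagonal_mul, zero_pow (by omega), zero_mul,
    add_zero]

theorem Vpoly_zero_apply_lst (E : Matrix (JIdx k s) (JIdx k s) ℂ) {i : Size k} (hi : ρ.1 ≤ i.1)
    (a : Fin (s i.1)) :
    Vpoly D Ξ Sg ρ 0 E ⟨i, lst i, a⟩ = (E * (R s ρ 0 * G D Ξ Sg ρ)) ⟨i, lst i, a⟩ := by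
  have := i.one_le
  ext q
  rw [Vpoly, Matrix.add_apply, N_apply_of_not_lt (by rw [lst_val]; omega), Pi.zero_apply, zero_add,
    mul_assoc, Matrix.diagonal_mul, lst_val,
    show ρ.1 - (i.1 - 1 + 1 - (i.1 - ρ.1)) = 0 by omega, pow_zero, one_mul]

theorem mulVec_eq_tailFirst_mulVec {i : ℕ} {w : JIdx k s → ℂ}
    (h : ∀ p : JIdx k s, ¬ (i ≤ p.1.1 ∧ (p.2.1 : ℕ) = 0) → w p = 0) :
    Ξ *ᵥ w = tailFirst Ξ i *ᵥ fun p => w ⟨p.1.1, fst p.1.1, p.1.2⟩ :=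
  funext fun r => sum_eq_sum_tail _ fun p hp => by rw [h p hp, mul_zero]

/-- `R G Y` at `z = 0`, for the limit of `Y` as `t → 0`. -/
noncomputable def leadRows : Matrix (JIdx k s) (Blk s ρ) ℂ :=
  R s ρ 0 * G D Ξ Sg ρ * blockIncl s ρ

theorem leadRows_apply (p : JIdx k s) (y : Blk s ρ) :
    leadRows D Ξ Sg ρ p y = 0 ^ ((p.2.1 : ℕ) - (p.1.1 - ρ.1)) * G D Ξ Sg ρ p ⟨ρ, y⟩ := by
  rw [leadRows, mul_blockIncl_apply, R, Matrix.diagonal_mul]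

theorem leadRows_apply_of_not {p : JIdx k s} (h : ¬ (ρ.1 ≤ p.1.1 ∧ (p.2.1 : ℕ) = 0))
    (y : Blk s ρ) : leadRows D Ξ Sg ρ p y = 0 := by
  rw [leadRows_apply, G_apply_of_not D Ξ Sg ρ fun h' => h ⟨h'.1.le, h'.2⟩]
  by_cases hp : p.1 = ρ
  · obtain ⟨i, l, a⟩ := p
    obtain rfl : i = ρ := hp
    rw [zero_pow (by simp only at h ⊢; omega), zero_mul]
  · rw [Pi.single_eq_of_ne fun h' => hp (congrArg Sigma.fst h').symm, mul_zero]

theorem leadRows_apply_fst {i : Size k} (h : ρ.1 ≤ i.1) (a : Fin (s i.1)) (y : Blk s ρ) :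
    leadRows D Ξ Sg ρ ⟨i, fst i, a⟩ y = lead D Ξ Sg ρ ⟨⟨i, a⟩, h⟩ y := by
  rw [leadRows_apply, fst_val, Nat.zero_sub, pow_zero, one_mul]
  rcases h.lt_or_eq with hlt | heq
  · have hne : i ≠ ρ := fun h' => hlt.ne (congrArg Subtype.val h').symm
    simp only [G, Sigma.mk.injEq, hne, false_and, ↓reduceIte, Nat.succ_le_of_lt hlt, le_refl,
      true_and, zero_add, lead, ↓reduceDIte]
    rfl
  · obtain rfl : ρ = i := Subtype.ext heq
    rw [G_apply_of_not D Ξ Sg ρ (by simp)]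
    simp [lead, Pi.single_apply, Prod.ext_iff, ← ite_and, ← Fin.ext_iff, eq_comm]

theorem mul_leadRows : Ξ * leadRows D Ξ Sg ρ = tailFirst Ξ ρ.1 * lead D Ξ Sg ρ := by
  ext r y
  refine (congrFun (mulVec_eq_tailFirst_mulVec Ξ
    fun p hp => leadRows_apply_of_not D Ξ Sg ρ hp y) r).trans ?_
  exact Finset.sum_congr rfl fun p _ =>
    congrArg (tailFirst Ξ ρ.1 r p * ·) (leadRows_apply_fst D Ξ Sg ρ p.2 p.1.2 y)

variable {D Ξ Sg ρ}

theorem Vpoly_zero_mul_blockIncl_apply_lst {i : Size k} (hi : ρ.1 ≤ i.1) (a : Fin (s i.1))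
    (y : Blk s ρ) :
    (Vpoly D Ξ Sg ρ 0 (Sgᴴ * D * Ξ) * blockIncl s ρ) ⟨i, lst i, a⟩ y =
      if y.1 = fst ρ then ((lastCol Sg i)ᴴ * D * leadCol D Ξ Sg ρ) a y.2 else 0 := by
  calc (Vpoly D Ξ Sg ρ 0 (Sgᴴ * D * Ξ) * blockIncl s ρ) ⟨i, lst i, a⟩ y
      = (Sgᴴ * D * Ξ * (R s ρ 0 * G D Ξ Sg ρ) * blockIncl s ρ) ⟨i, lst i, a⟩ y := by
        rw [mul_blockIncl_apply, Vpoly_zero_apply_lst D Ξ Sg ρ _ hi, mul_blockIncl_apply]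
    _ = (Sgᴴ * D * (tailFirst Ξ ρ.1 * lead D Ξ Sg ρ)) ⟨i, lst i, a⟩ y := by
        rw [← mul_leadRows, leadRows, Matrix.mul_assoc, Matrix.mul_assoc _ Ξ]
    _ = _ := by
        rw [Matrix.mul_apply]
        simp only [tailFirst_mul_lead_apply]
        split_ifs
        · rfl
        · simp only [mul_zero, Finset.sum_const_zero]

theorem Vpoly_zero_mul_blockIncl (hW : IsUnit (W D Ξ Sg (ρ.1 + 1))) :
    Vpoly D Ξ Sg ρ 0 (Sgᴴ * D * Ξ) * blockIncl s ρ = blockIncl s ρ * Theta D Ξ Sg ρ := by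
  ext ⟨i, l, a⟩ y
  by_cases hp : i.1 < ρ.1 ∨ (l : ℕ) + 1 < i.1
  · rw [mul_blockIncl_apply, Vpoly_zero_apply_of_not D Ξ Sg ρ _ hp,
      ← mul_blockIncl_apply ρ (N k s) ⟨i, l, a⟩ y]
    by_cases hl : (l : ℕ) + 1 < i.1
    · rw [mul_apply_of_row_eq_single (N_apply_of_lt hl a)]
      rcases eq_or_ne i ρ with rfl | hne
      · rw [mul_apply_of_row_eq_single (blockIncl_apply_self i _), Theta_apply_of_lt hl,
          blockIncl_apply_self]
      · rw [mul_apply_of_row_eq_zero (blockIncl_apply_of_ne hne),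
          blockIncl_apply_of_ne (p := ⟨i, _⟩) hne, Pi.zero_apply]
    · have hne : i ≠ ρ := fun h => (hp.resolve_right hl).ne (congrArg Subtype.val h)
      rw [mul_apply_of_row_eq_zero (N_apply_of_not_lt hl a),
        mul_apply_of_row_eq_zero (blockIncl_apply_of_ne hne)]
  · push Not at hp
    obtain rfl : l = lst i := eq_lst_iff.2 (le_antisymm l.2 hp.2)
    rw [Vpoly_zero_mul_blockIncl_apply_lst hp.1]
    rcases eq_or_ne i ρ with rfl | hne
    · rw [mul_apply_of_row_eq_single (blockIncl_apply_self i _), lastCol_mul_leadCol,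
        Theta_apply_lst]
    · have hlt : ρ.1 + 1 ≤ i.1 := hp.1.lt_of_ne fun h => hne (Subtype.ext h.symm)
      rw [mul_apply_of_row_eq_zero (blockIncl_apply_of_ne hne), ite_eq_right_iff]
      exact fun _ => congrFun (congrFun (tailLast_mul_leadCol hW) ⟨⟨i, a⟩, hlt⟩) y.2

variable {w : JIdx k s → ℂ} {μ : ℂ}

theorem eq_zero_of_N_mulVec_eq_smul {i : Size k} (hμ : μ ≠ 0)
    (h : ∀ l a, (N k s *ᵥ w) ⟨i, l, a⟩ = μ * w ⟨i, l, a⟩) (l : Fin i.1) (a : Fin (s i.1)) :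
    w ⟨i, l, a⟩ = 0 := by
  induction hd : i.1 - (l : ℕ) generalizing l with
  | zero => exact absurd hd (by have := l.2; omega)
  | succ d ih =>
    refine (mul_eq_zero_iff_left hμ).1 ((h l a).symm.trans ?_)
    by_cases hl : (l : ℕ) + 1 < i.1
    · rw [mulVec_apply_of_row_eq_single (N_apply_of_lt hl a)]
      exact ih _ (by simp only; omega)
    · exact mulVec_apply_of_row_eq_zero (N_apply_of_not_lt hl a) w

theorem eq_zero_of_N_mulVec_eq_Upoly_mulVec {i : Size k} (hi : ρ.1 < i.1)
    (h : ∀ (l : Fin i.1) a, (l : ℕ) + 1 < i.1 →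
      (N k s *ᵥ w) ⟨i, l, a⟩ = μ * (Upoly D Ξ Sg ρ 0 *ᵥ w) ⟨i, l, a⟩)
    {l : ℕ} (hl : l + 1 < i.1) (a : Fin (s i.1)) : w ⟨i, ⟨l + 1, hl⟩, a⟩ = 0 := by
  induction l with
  | zero =>
    rw [← mulVec_apply_of_row_eq_single (N_apply_of_lt (l := ⟨0, by omega⟩) hl a) w, h _ _ hl,
      mulVec_apply_of_row_eq_zero (Upoly_zero_apply_of_lt D Ξ Sg ρ (by simpa)), mul_zero]
  | succ l ih =>
    rw [← mulVec_apply_of_row_eq_single (N_apply_of_lt (l := ⟨l + 1, by omega⟩) hl a) w, h _ _ hl]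
    by_cases hU : l + 1 + ρ.1 < i.1
    · rw [mulVec_apply_of_row_eq_zero (Upoly_zero_apply_of_lt D Ξ Sg ρ hU), mul_zero]
    · rw [mulVec_apply_of_row_eq_single (Upoly_apply_of_not D Ξ Sg ρ 0 hU), ih, mul_zero]

theorem eq_zero_of_Vpoly_mulVec_lst (hW : IsUnit (W D Ξ Sg (ρ.1 + 1)))
    (hw : ∀ p : JIdx k s, ¬ (ρ.1 + 1 ≤ p.1.1 ∧ (p.2.1 : ℕ) = 0) → w p = 0)
    (h : ∀ i : Size k, ρ.1 < i.1 → ∀ a,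
      (Vpoly D Ξ Sg ρ 0 (Sgᴴ * D * Ξ) *ᵥ w) ⟨i, lst i, a⟩ = 0) : w = 0 := by
  have hRG : (R s ρ 0 * G D Ξ Sg ρ) *ᵥ w = w := by
    rw [← Matrix.mulVec_mulVec, G_mulVec_eq_self D Ξ Sg ρ fun p hp => hw p (by omega)]
    ext p
    rw [R, Matrix.mulVec_diagonal]
    by_cases hp : ρ.1 + 1 ≤ p.1.1 ∧ (p.2.1 : ℕ) = 0
    · rw [hp.2, Nat.zero_sub, pow_zero, one_mul]
    · rw [hw p hp, mul_zero]
  have htail : (fun p : Tail k s (ρ.1 + 1) => w ⟨p.1.1, fst p.1.1, p.1.2⟩) = 0 := by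
    refine Matrix.mulVec_injective_of_isUnit hW (funext fun p => ?_)
    rw [W, ← Matrix.mulVec_mulVec, ← mulVec_eq_tailFirst_mulVec Ξ hw, Matrix.mulVec_zero,
      Pi.zero_apply, ← h p.1.1 p.2 p.1.2]
    calc _ = ((Sgᴴ * D) *ᵥ Ξ *ᵥ (R s ρ 0 * G D Ξ Sg ρ) *ᵥ w) ⟨p.1.1, lst p.1.1, p.1.2⟩ := by
          rw [hRG]
          rfl
      _ = ((Sgᴴ * D * Ξ * (R s ρ 0 * G D Ξ Sg ρ)) *ᵥ w) ⟨p.1.1, lst p.1.1, p.1.2⟩ := by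
          rw [Matrix.mulVec_mulVec, Matrix.mulVec_mulVec]
      _ = _ := congrArg (· ⬝ᵥ w)
          (Vpoly_zero_apply_lst D Ξ Sg ρ (Sgᴴ * D * Ξ) ((Nat.le_succ _).trans p.2) p.1.2).symm
  ext p
  by_cases hp : ρ.1 + 1 ≤ p.1.1 ∧ (p.2.1 : ℕ) = 0
  · obtain ⟨i, l, a⟩ := p
    obtain rfl : l = fst i := eq_fst_iff.2 hp.2
    exact congrFun htail ⟨⟨i, a⟩, hp.1⟩
  · exact hw p hp

theorem eq_zero_of_leading_pencil (hW : IsUnit (W D Ξ Sg (ρ.1 + 1))) (hμ : μ ≠ 0)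
    (hρ : ∀ x, w ⟨ρ, x⟩ = 0)
    (h : ∀ p : JIdx k s, p.1 ≠ ρ →
      (Vpoly D Ξ Sg ρ 0 (Sgᴴ * D * Ξ) *ᵥ w) p = μ * (Upoly D Ξ Sg ρ 0 *ᵥ w) p) : w = 0 := by
  have hN : ∀ p : JIdx k s, p.1 ≠ ρ → (p.1.1 < ρ.1 ∨ (p.2.1 : ℕ) + 1 < p.1.1) →
      (N k s *ᵥ w) p = μ * (Upoly D Ξ Sg ρ 0 *ᵥ w) p := fun p hp hp' =>
    (congrArg (· ⬝ᵥ w) (Vpoly_zero_apply_of_not D Ξ Sg ρ _ hp')).symm.trans (h p hp)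
  have hlt : ∀ i : Size k, i.1 < ρ.1 → ∀ l a, w ⟨i, l, a⟩ = 0 := fun i hi =>
    eq_zero_of_N_mulVec_eq_smul hμ fun l a => by
      rw [hN ⟨i, l, a⟩ (fun h => hi.ne (congrArg Subtype.val h)) (.inl hi),
        mulVec_apply_of_row_eq_single (Upoly_apply_of_not D Ξ Sg ρ 0 (by simp only; omega))]
  have hgt : ∀ i : Size k, ρ.1 < i.1 → ∀ (l : ℕ) (hl : l + 1 < i.1) a,
      w ⟨i, ⟨l + 1, hl⟩, a⟩ = 0 := fun i hi l hl =>
    eq_zero_of_N_mulVec_eq_Upoly_mulVec hi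
      (fun l a hl => hN ⟨i, l, a⟩ (fun h => hi.ne' (congrArg Subtype.val h)) (.inr hl)) hl
  refine eq_zero_of_Vpoly_mulVec_lst hW ?_ fun i hi a => ?_
  · rintro ⟨i, ⟨_ | l, hl⟩, a⟩ hp
    · rcases lt_trichotomy i.1 ρ.1 with hi | hi | hi
      · exact hlt i hi _ a
      · obtain rfl : i = ρ := Subtype.ext hi
        exact hρ _
      · exact absurd ⟨hi, rfl⟩ hp
    · rcases lt_trichotomy i.1 ρ.1 with hi | hi | hi
      · exact hlt i hi _ a
      · obtain rfl : i = ρ := Subtype.ext hi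
        exact hρ _
      · exact hgt i hi l hl a
  · have := ρ.one_le
    have hlst : lst i = ⟨i.1 - 2 + 1, by omega⟩ := Fin.ext (by rw [lst_val]; simp only; omega)
    rw [h _ fun h => hi.ne' (congrArg Subtype.val h), mulVec_apply_of_row_eq_single
      (Upoly_apply_of_not D Ξ Sg ρ 0 (by simp only [lst_val]; omega)), hlst, hgt i hi, mul_zero]

theorem splitPencil (hW : IsUnit (W D Ξ Sg ρ.1)) (hW' : IsUnit (W D Ξ Sg (ρ.1 + 1))) :
    SplitPencil (blockIncl s ρ)ᵀ (blockIncl s ρ) (Upoly D Ξ Sg ρ 0)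
      (Vpoly D Ξ Sg ρ 0 (Sgᴴ * D * Ξ)) (Theta D Ξ Sg ρ) where
  left_inv := blockIncl_transpose_mul_self ρ
  mul_U := blockIncl_transpose_mul_Upoly D Ξ Sg ρ 0
  U_mul := Upoly_zero_mul_blockIncl D Ξ Sg ρ
  V_mul := Vpoly_zero_mul_blockIncl hW'
  isUnit := isUnit_Theta (isUnit_S hW hW')
  eq_zero_of_quotient μ hμ w hKw := by
    rintro ⟨b, hb⟩
    refine eq_zero_of_leading_pencil hW' hμ
      (fun x => (blockIncl_transpose_mulVec_apply ρ w x).symm.trans (congrFun hKw x)) fun p hp => ?_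
    rw [← sub_eq_zero]
    exact (congrFun hb p).trans (mulVec_apply_of_row_eq_zero (blockIncl_apply_of_ne hp) b)

end ScaledPencil

section JordanChains

attribute [local instance] Matrix.normedAddCommGroup Matrix.normedSpace

variable {α : Type*} {f : Filter α} {z : α → ℂ}

theorem isBigO_pow_of_le (hz : Tendsto z f (𝓝 0)) {i j : ℕ} (h : j ≤ i) :
    (fun t => z t ^ i) =O[f] fun t => z t ^ j := by
  have hone : (fun t => z t ^ (i - j)) =O[f] fun _ => (1 : ℂ) := (hz.pow (i - j)).isBigO_one ℂ
  simpa only [← pow_add, Nat.sub_add_cancel h, one_mul] using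
    hone.mul (isBigO_refl (fun t => z t ^ j) f)

theorem isBigO_of_mul_isBigO_pow_succ (hz : ∀ᶠ t in f, z t ≠ 0) {g : α → ℂ} {j : ℕ}
    (h : (fun t => z t * g t) =O[f] fun t => z t ^ (j + 1)) : g =O[f] fun t => z t ^ j := by
  refine ((isBigO_refl (fun t => (z t)⁻¹) f).mul h).congr' ?_ ?_ <;>
    filter_upwards [hz] with t ht
  · rw [inv_mul_cancel_left₀ ht]
  · rw [pow_succ', inv_mul_cancel_left₀ ht]

variable {k : ℕ} {s : ℕ → ℕ} {β : Type*} [Fintype β]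

/-- A bounded family `Z` spanning invariant subspaces of the perturbed nilpotent matrices
`N + z ^ r E`, on which they act as `z Q`, where `z → 0` along the filter `f`. -/
structure IsScaledChain (f : Filter α) (z : α → ℂ) (r : ℕ)
    (E : α → Matrix (JIdx k s) (JIdx k s) ℂ) (Z : α → Matrix (JIdx k s) β ℂ)
    (Q : α → Matrix β β ℂ) : Prop where
  tendsto_zero : Tendsto z f (𝓝 0)
  isBigO_E : E =O[f] fun _ => (1 : ℂ)
  isBigO_Z : Z =O[f] fun _ => (1 : ℂ)
  isBigO_Q : Q =O[f] fun _ => (1 : ℂ)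
  mul_eq : ∀ᶠ t in f, (N k s + z t ^ r • E t) * Z t = z t • (Z t * Q t)

namespace IsScaledChain

variable {r : ℕ} {E : α → Matrix (JIdx k s) (JIdx k s) ℂ} {Z : α → Matrix (JIdx k s) β ℂ}
  {Q Q' : α → Matrix β β ℂ}

theorem isBigO_perturbation (h : IsScaledChain f z r E Z Q) (p : JIdx k s) (y : β) :
    (fun t => (z t ^ r • E t * Z t) p y) =O[f] fun t => z t ^ r := by
  have hEZ := isBigO_mul_apply (isBigO_matrix.1 h.isBigO_E p) (isBigO_matrix.1 h.isBigO_Z · y)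
  simpa only [Matrix.smul_mul, Matrix.smul_apply, smul_eq_mul, mul_one] using
    (isBigO_refl (fun t => z t ^ r) f).mul hEZ

theorem eventually_N_mul_add_eq (h : IsScaledChain f z r E Z Q) (p : JIdx k s) (y : β) :
    ∀ᶠ t in f, (N k s * Z t) p y + (z t ^ r • E t * Z t) p y = z t * (Z t * Q t) p y := by
  filter_upwards [h.mul_eq] with t ht
  have hrow := congrFun (congrFun ht p) y
  rwa [Matrix.add_mul] at hrow

theorem isBigO_pow_min (h : IsScaledChain f z r E Z Q) {i : Size k} {l : ℕ} (hl : l < i.1)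
    (a : Fin (s i.1)) (y : β) :
    (fun t => Z t ⟨i, ⟨l, hl⟩, a⟩ y) =O[f] fun t => z t ^ min l r := by
  induction l generalizing y with
  | zero =>
    simp only [Nat.zero_min, pow_zero]
    exact isBigO_matrix.1 h.isBigO_Z ⟨i, ⟨0, hl⟩, a⟩ y
  | succ l ih =>
    have hl' : l < i.1 := by omega
    let p : JIdx k s := ⟨i, ⟨l, hl'⟩, a⟩
    have hZQ : (fun t => z t * (Z t * Q t) p y) =O[f] fun t => z t ^ min (l + 1) r := by
      have hstep := isBigO_mul_apply (ih hl') (isBigO_matrix.1 h.isBigO_Q · y)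
      refine ((isBigO_refl z f).mul hstep).trans ?_
      simpa only [mul_one, ← pow_succ'] using
        isBigO_pow_of_le h.tendsto_zero (show min (l + 1) r ≤ min l r + 1 by omega)
    have hEZ := (h.isBigO_perturbation p y).trans
      (isBigO_pow_of_le h.tendsto_zero (min_le_right (l + 1) r))
    refine (hZQ.sub hEZ).congr' ?_ .rfl
    filter_upwards [h.eventually_N_mul_add_eq p y] with t ht
    rw [mul_apply_of_row_eq_single (N_apply_of_lt hl a)] at ht
    exact (eq_sub_of_add_eq ht).symm

variable [DecidableEq β]

theorem isBigO_pow_of_N_mul (h : IsScaledChain f z r E Z Q) (hz : ∀ᶠ t in f, z t ≠ 0)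
    (hQ' : Q' =O[f] fun _ => (1 : ℂ)) (hQ : ∀ᶠ t in f, Q t * Q' t = 1) {p : JIdx k s} {j : ℕ}
    (hj : j < r) (hN : ∀ x, (fun t => (N k s * Z t) p x) =O[f] fun t => z t ^ (j + 1)) (y : β) :
    (fun t => Z t p y) =O[f] fun t => z t ^ j := by
  have hZQ : ∀ x, (fun t => (Z t * Q t) p x) =O[f] fun t => z t ^ j := fun x =>
    isBigO_of_mul_isBigO_pow_succ hz <| ((hN x).add <| (h.isBigO_perturbation p x).trans <|
      isBigO_pow_of_le h.tendsto_zero hj).congr' (h.eventually_N_mul_add_eq p x) .rfl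
  refine (isBigO_mul_apply hZQ (isBigO_matrix.1 hQ' · y)).congr' ?_ (.of_forall fun t => mul_one _)
  filter_upwards [hQ] with t ht
  rw [Matrix.mul_assoc, ht, Matrix.mul_one]

theorem isBigO_pow_sub (h : IsScaledChain f z r E Z Q) (hz : ∀ᶠ t in f, z t ≠ 0)
    (hQ' : Q' =O[f] fun _ => (1 : ℂ)) (hQ : ∀ᶠ t in f, Q t * Q' t = 1) {i : Size k} (hi : i.1 ≤ r)
    (l : Fin i.1) (a : Fin (s i.1)) (y : β) :
    (fun t => Z t ⟨i, l, a⟩ y) =O[f] fun t => z t ^ (r - i.1 + l) := by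
  induction hd : i.1 - (l : ℕ) generalizing l y with
  | zero => exact absurd hd (by have := l.2; omega)
  | succ d ih =>
    refine h.isBigO_pow_of_N_mul hz hQ' hQ (by have := l.2; omega) (fun x => ?_) y
    by_cases hl : (l : ℕ) + 1 < i.1
    · exact (ih ⟨l + 1, hl⟩ x (by simp only; omega)).congr_left fun t =>
        (mul_apply_of_row_eq_single (N_apply_of_lt hl a) _ x).symm
    · exact (isBigO_zero _ _).congr_left fun t =>
        (mul_apply_of_row_eq_zero (N_apply_of_not_lt hl a) _ x).symm

end IsScaledChain

end JordanChains

section Root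

variable {k : ℕ} (ρ : Size k) {t : ℝ}

theorem root_pos (ht : 0 < t) : 0 < root ρ t := Real.rpow_pos_of_pos ht _

theorem root_pow (ht : 0 < t) (j : ℕ) : root ρ t ^ j = t ^ ((j : ℝ) / (ρ.1 : ℝ)) := by
  rw [root, ← Real.rpow_natCast, ← Real.rpow_mul ht.le, one_div_mul_eq_div]

theorem Size.cast_ne_zero : (ρ.1 : ℝ) ≠ 0 := Nat.cast_ne_zero.2 (Nat.one_le_iff_ne_zero.1 ρ.one_le)

theorem root_pow_self (ht : 0 < t) : root ρ t ^ ρ.1 = t := by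
  rw [root_pow ρ ht, div_self ρ.cast_ne_zero, Real.rpow_one]

theorem tendsto_root : Tendsto (root ρ) (𝓝[>] 0) (𝓝 0) := by
  have hexp : 0 < 1 / (ρ.1 : ℝ) := one_div_pos.2 (Nat.cast_pos.2 ρ.one_le)
  have hcont := (Real.continuousAt_rpow_const 0 (1 / (ρ.1 : ℝ)) (.inr hexp.le)).tendsto
  rw [Real.zero_rpow hexp.ne'] at hcont
  exact hcont.mono_left nhdsWithin_le_nhds

theorem tendsto_coe_root : Tendsto (fun t => (root ρ t : ℂ)) (𝓝[>] 0) (𝓝 0) := by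
  simpa only [Complex.ofReal_zero] using (tendsto_root ρ).ofReal

theorem eventually_coe_root_ne_zero : ∀ᶠ t in 𝓝[>] 0, (root ρ t : ℂ) ≠ 0 := by
  filter_upwards [self_mem_nhdsWithin] with t ht
  exact Complex.ofReal_ne_zero.2 (root_pos ρ ht).ne'

theorem coe_root_pow_self (ht : 0 < t) : (root ρ t : ℂ) ^ ρ.1 = t := by
  exact_mod_cast root_pow_self ρ ht

theorem isBigO_coe_root_pow_iff {E : Type*} [Norm E] {g : ℝ → E} {j : ℕ} :
    (g =O[𝓝[>] 0] fun t => (root ρ t : ℂ) ^ j) ↔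
      g =O[𝓝[>] 0] fun t => t ^ ((j : ℝ) / (ρ.1 : ℝ)) := by
  rw [← isBigO_norm_right]
  refine isBigO_congr .rfl ?_
  filter_upwards [self_mem_nhdsWithin] with t ht
  rw [norm_pow, Complex.norm_real, Real.norm_of_nonneg (root_pos ρ ht).le, root_pow ρ ht]

theorem isBigO_rpow_one_root : (fun t : ℝ => t ^ (1 : ℝ)) =O[𝓝[>] 0] root ρ :=
  (IsBigO.rpow_rpow_nhdsGE_zero_of_le
    (div_le_one_of_le₀ (Nat.one_le_cast.2 ρ.one_le) (Nat.cast_nonneg _)) one_ne_zero).mono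
      (nhdsWithin_mono 0 Set.Ioi_subset_Ici_self)

end Root

section DeflatingFamily

attribute [local instance] Matrix.normedAddCommGroup Matrix.normedSpace

variable {n k : ℕ} {s : ℕ → ℕ}
variable (D : Matrix (Fin n) (Fin n) ℂ) (Ξ Sg : Matrix (Fin n) (JIdx k s) ℂ) (ρ : Size k)

/-- The matrix `Θ̂_ρ`: the rows of `V̂(z) Y` that belong to the Jordan blocks of size `ρ`. -/
noncomputable def thetaHat (E : Matrix (JIdx k s) (JIdx k s) ℂ) (z : ℂ)
    (Y : Matrix (JIdx k s) (Blk s ρ) ℂ) : Matrix (Blk s ρ) (Blk s ρ) ℂ :=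
  (blockIncl s ρ)ᵀ * (Vhat D Ξ Sg E ρ z * Y)

/-- The matrix `R G Y`, which undoes the scaling of the columns of the pencil. -/
noncomputable def unscaled (z : ℂ) (Y : Matrix (JIdx k s) (Blk s ρ) ℂ) :
    Matrix (JIdx k s) (Blk s ρ) ℂ :=
  R s ρ z * G D Ξ Sg ρ * Y

theorem Uhat_eq_smul (z : ℂ) : Uhat D Ξ Sg ρ z = z • (L s ρ z * (R s ρ z * G D Ξ Sg ρ)) := by
  simp only [Uhat, mul_smul_comm, smul_mul_assoc, mul_one, mul_assoc]

theorem Vhat_eq_mul (E : Matrix (JIdx k s) (JIdx k s) ℂ) (z : ℂ) :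
    Vhat D Ξ Sg E ρ z = L s ρ z * (N k s + z ^ ρ.1 • E) * (R s ρ z * G D Ξ Sg ρ) :=
  mul_assoc _ _ _

theorem unscaled_apply (z : ℂ) (Y : Matrix (JIdx k s) (Blk s ρ) ℂ) (p : JIdx k s) (y : Blk s ρ) :
    unscaled D Ξ Sg ρ z Y p y =
      z ^ ((p.2.1 : ℕ) - (p.1.1 - ρ.1)) * (G D Ξ Sg ρ * Y) p y := by
  rw [unscaled, Matrix.mul_assoc, R, Matrix.diagonal_mul]

theorem unscaled_apply_self {z : ℂ} {Y : Matrix (JIdx k s) (Blk s ρ) ℂ}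
    (hY : (blockIncl s ρ)ᵀ * Y = 1) (x y : Blk s ρ) :
    unscaled D Ξ Sg ρ z Y ⟨ρ, x⟩ y = z ^ (x.1 : ℕ) * (1 : Matrix _ _ ℂ) x y := by
  rw [unscaled_apply, mul_apply_of_row_eq_single (G_apply_of_not D Ξ Sg ρ (by simp)),
    ← blockIncl_transpose_mul_apply ρ Y x y, hY, Nat.sub_self, Nat.sub_zero]

theorem tendsto_Uhat : Tendsto (fun t => Uhat D Ξ Sg ρ (root ρ t)) (𝓝[>] 0)
    (𝓝 (Upoly D Ξ Sg ρ 0)) := by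
  refine (((contDiff_Upoly D Ξ Sg ρ contDiff_id).continuous.tendsto 0).comp
    (tendsto_coe_root ρ)).congr' ?_
  filter_upwards [eventually_coe_root_ne_zero ρ] with t hz
  exact (Uhat_eq_Upoly D Ξ Sg ρ hz).symm

variable {D Ξ Sg ρ}
variable {E : ℝ → Matrix (JIdx k s) (JIdx k s) ℂ} {Y : ℝ → Matrix (JIdx k s) (Blk s ρ) ℂ}

theorem isBigO_parameters (hE : (fun t => E t - Sgᴴ * D * Ξ) =O[𝓝[>] 0] root ρ) :
    (fun t => ((root ρ t : ℂ), E t) - (0, Sgᴴ * D * Ξ)) =O[𝓝[>] 0] root ρ :=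
  isBigO_prod_left.2 ⟨isBigO_of_le _ fun t => by simp, hE⟩

theorem isBigO_Vhat_sub (hE : (fun t => E t - Sgᴴ * D * Ξ) =O[𝓝[>] 0] root ρ) :
    (fun t => Vhat D Ξ Sg (E t) ρ (root ρ t) - Vpoly D Ξ Sg ρ 0 (Sgᴴ * D * Ξ))
      =O[𝓝[>] 0] root ρ := by
  have hp := isBigO_parameters hE
  have hV := (contDiff_Vpoly D Ξ Sg ρ contDiff_fst contDiff_snd).differentiable one_ne_zero
    ((0 : ℂ), Sgᴴ * D * Ξ)
  refine ((hV.hasFDerivAt.isBigO_sub.comp_tendsto (tendsto_sub_nhds_zero_iff.1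
    (hp.trans_tendsto (tendsto_root ρ)))).trans hp).congr' ?_ .rfl
  filter_upwards [eventually_coe_root_ne_zero ρ] with t hz
  simp only [Function.comp_apply, Vhat_eq_Vpoly D Ξ Sg ρ hz]

theorem isBigO_thetaHat_sub_Theta (hW' : IsUnit (W D Ξ Sg (ρ.1 + 1)))
    (hE : (fun t => E t - Sgᴴ * D * Ξ) =O[𝓝[>] 0] root ρ)
    (hY : (fun t => Y t - blockIncl s ρ) =O[𝓝[>] 0] root ρ) :
    (fun t => thetaHat D Ξ Sg ρ (E t) (root ρ t) (Y t) - Theta D Ξ Sg ρ) =O[𝓝[>] 0] root ρ := by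
  have hVY := isBigO_matrix_mul_sub_mul (tendsto_root ρ) (isBigO_Vhat_sub hE) hY
  rw [Vpoly_zero_mul_blockIncl hW'] at hVY
  refine isBigO_matrix.2 fun x y => (isBigO_matrix.1 hVY ⟨ρ, x⟩ y).congr_left fun t => ?_
  rw [Matrix.sub_apply, Matrix.sub_apply, thetaHat, blockIncl_transpose_mul_apply,
    mul_apply_of_row_eq_single (blockIncl_apply_self ρ x)]

variable (D Ξ Sg ρ E Y) in
/-- As `t → 0`, the columns of `Y t` span deflating subspaces of the scaled pencils with
`z = t^{1/ρ}` and perturbation `E t`, and are normalized by the rows that belong to `ρ`. -/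
structure IsDeflatingFamily : Prop where
  isBigO_E : (fun t => E t - Sgᴴ * D * Ξ) =O[𝓝[>] 0] root ρ
  isBigO_Y : (fun t => Y t - blockIncl s ρ) =O[𝓝[>] 0] root ρ
  rows_eq_one : ∀ᶠ t in 𝓝[>] 0, (blockIncl s ρ)ᵀ * Y t = 1
  deflates : ∀ᶠ t in 𝓝[>] 0, Uhat D Ξ Sg ρ (root ρ t) * Y t *
    thetaHat D Ξ Sg ρ (E t) (root ρ t) (Y t) = Vhat D Ξ Sg (E t) ρ (root ρ t) * Y t

theorem blockIncl_transpose_mul_Uhat {z : ℂ} (hz : z ≠ 0) :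
    (blockIncl s ρ)ᵀ * Uhat D Ξ Sg ρ z = (blockIncl s ρ)ᵀ := by
  rw [Uhat_eq_Upoly D Ξ Sg ρ hz, blockIncl_transpose_mul_Upoly]

-- The normalization is automatic, because the rows of `Û` that belong to `ρ` are those of `I`.
theorem exists_isDeflatingFamily (hW : IsUnit (W D Ξ Sg ρ.1))
    (hW' : IsUnit (W D Ξ Sg (ρ.1 + 1)))
    (hE : (fun t => E t - Sgᴴ * D * Ξ) =O[𝓝[>] 0] root ρ) :
    ∃ Y, IsDeflatingFamily D Ξ Sg ρ E Y := by
  obtain ⟨Y, hY, hsol⟩ := SplitPencil.exists_deflating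
    (p := fun t => ((root ρ t : ℂ), E t)) (p₀ := (0, Sgᴴ * D * Ξ))
    (U := fun q : ℂ × Matrix (JIdx k s) (JIdx k s) ℂ => Upoly D Ξ Sg ρ q.1)
    (V := fun q => Vpoly D Ξ Sg ρ q.1 q.2) (splitPencil hW hW')
    (contDiff_Upoly D Ξ Sg ρ contDiff_fst)
    (contDiff_Vpoly D Ξ Sg ρ contDiff_fst contDiff_snd) (tendsto_root ρ) (isBigO_parameters hE)
  have hdef : ∀ᶠ t in 𝓝[>] 0, Uhat D Ξ Sg ρ (root ρ t) * Y t *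
      thetaHat D Ξ Sg ρ (E t) (root ρ t) (Y t) = Vhat D Ξ Sg (E t) ρ (root ρ t) * Y t := by
    filter_upwards [hsol, eventually_coe_root_ne_zero ρ] with t hsol hz
    rw [thetaHat, Uhat_eq_Upoly D Ξ Sg ρ hz, Vhat_eq_Vpoly D Ξ Sg ρ hz, hsol]
  have hΘ := tendsto_sub_nhds_zero_iff.1
    ((isBigO_thetaHat_sub_Theta hW' hE hY).trans_tendsto (tendsto_root ρ))
  refine ⟨Y, hE, hY, ?_, hdef⟩
  filter_upwards [hdef, eventually_coe_root_ne_zero ρ,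
    eventually_isUnit_of_tendsto hΘ (splitPencil hW hW').isUnit] with t hdef hz hunit
  exact mul_eq_one_of_deflating (blockIncl_transpose_mul_Uhat hz) hunit hdef rfl

namespace IsDeflatingFamily

theorem tendsto_E (h : IsDeflatingFamily D Ξ Sg ρ E Y) :
    Tendsto E (𝓝[>] 0) (𝓝 (Sgᴴ * D * Ξ)) :=
  tendsto_sub_nhds_zero_iff.1 (h.isBigO_E.trans_tendsto (tendsto_root ρ))

theorem tendsto_Y (h : IsDeflatingFamily D Ξ Sg ρ E Y) :
    Tendsto Y (𝓝[>] 0) (𝓝 (blockIncl s ρ)) :=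
  tendsto_sub_nhds_zero_iff.1 (h.isBigO_Y.trans_tendsto (tendsto_root ρ))

theorem tendsto_Vhat (h : IsDeflatingFamily D Ξ Sg ρ E Y) :
    Tendsto (fun t => Vhat D Ξ Sg (E t) ρ (root ρ t)) (𝓝[>] 0)
      (𝓝 (Vpoly D Ξ Sg ρ 0 (Sgᴴ * D * Ξ))) :=
  tendsto_sub_nhds_zero_iff.1 ((isBigO_Vhat_sub h.isBigO_E).trans_tendsto (tendsto_root ρ))

theorem tendsto_thetaHat (h : IsDeflatingFamily D Ξ Sg ρ E Y)
    (hW' : IsUnit (W D Ξ Sg (ρ.1 + 1))) :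
    Tendsto (fun t => thetaHat D Ξ Sg ρ (E t) (root ρ t) (Y t)) (𝓝[>] 0)
      (𝓝 (Theta D Ξ Sg ρ)) :=
  tendsto_sub_nhds_zero_iff.1
    ((isBigO_thetaHat_sub_Theta hW' h.isBigO_E h.isBigO_Y).trans_tendsto (tendsto_root ρ))

theorem tendsto_unscaled (h : IsDeflatingFamily D Ξ Sg ρ E Y) :
    Tendsto (fun t => unscaled D Ξ Sg ρ (root ρ t) (Y t)) (𝓝[>] 0) (𝓝 (leadRows D Ξ Sg ρ)) := by
  have hRG : Continuous fun z => R s ρ z * G D Ξ Sg ρ := by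
    unfold R
    fun_prop
  have hmul : Continuous fun q : Matrix (JIdx k s) (JIdx k s) ℂ × Matrix (JIdx k s) (Blk s ρ) ℂ =>
      q.1 * q.2 := continuous_fst.matrix_mul continuous_snd
  have hRGt : Tendsto (fun t => R s ρ (root ρ t) * G D Ξ Sg ρ) (𝓝[>] 0)
      (𝓝 (R s ρ 0 * G D Ξ Sg ρ)) := (hRG.tendsto 0).comp (tendsto_coe_root ρ)
  have hlim := (hmul.tendsto (R s ρ 0 * G D Ξ Sg ρ, blockIncl s ρ)).comp
    (hRGt.prodMk_nhds h.tendsto_Y)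
  exact hlim

theorem eventually_mul_unscaled (h : IsDeflatingFamily D Ξ Sg ρ E Y) : ∀ᶠ t in 𝓝[>] 0,
    (N k s + (root ρ t : ℂ) ^ ρ.1 • E t) * unscaled D Ξ Sg ρ (root ρ t) (Y t) =
      (root ρ t : ℂ) • (unscaled D Ξ Sg ρ (root ρ t) (Y t) *
        thetaHat D Ξ Sg ρ (E t) (root ρ t) (Y t)) := by
  filter_upwards [h.deflates, eventually_coe_root_ne_zero ρ] with t hdef hz
  rw [Uhat_eq_smul, Vhat_eq_mul] at hdef
  exact mul_eq_smul_of_scaled (isUnit_L ρ hz) hdef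

theorem isScaledChain (h : IsDeflatingFamily D Ξ Sg ρ E Y) (hW' : IsUnit (W D Ξ Sg (ρ.1 + 1))) :
    IsScaledChain (𝓝[>] 0) (fun t => (root ρ t : ℂ)) ρ.1 E
      (fun t => unscaled D Ξ Sg ρ (root ρ t) (Y t))
      fun t => thetaHat D Ξ Sg ρ (E t) (root ρ t) (Y t) where
  tendsto_zero := tendsto_coe_root ρ
  isBigO_E := h.tendsto_E.isBigO_one ℂ
  isBigO_Z := h.tendsto_unscaled.isBigO_one ℂ
  isBigO_Q := (h.tendsto_thetaHat hW').isBigO_one ℂ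
  mul_eq := h.eventually_mul_unscaled

theorem eventually_injectiveModRange (h : IsDeflatingFamily D Ξ Sg ρ E Y)
    (hW : IsUnit (W D Ξ Sg ρ.1)) (hW' : IsUnit (W D Ξ Sg (ρ.1 + 1))) {c C : ℝ} (hc : 0 < c) :
    ∀ᶠ t in 𝓝[>] 0, ∀ μ : ℂ, c ≤ ‖μ‖ → ‖μ‖ ≤ C →
      InjectiveModRange (N k s + (root ρ t : ℂ) ^ ρ.1 • E t)
        (unscaled D Ξ Sg ρ (root ρ t) (Y t)) (root ρ t * μ) := by
  filter_upwards [(splitPencil hW hW').eventually_isUnit_quotientPencil (tendsto_Uhat D Ξ Sg ρ)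
    h.tendsto_Vhat h.tendsto_Y hc, h.deflates, h.rows_eq_one, eventually_coe_root_ne_zero ρ]
    with t hunit hdef hY hz μ hcμ hμC
  have hKU := blockIncl_transpose_mul_Uhat (ρ := ρ) (D := D) (Ξ := Ξ) (Sg := Sg) hz
  have hunit := hunit μ hcμ hμC
  rw [Uhat_eq_smul, Vhat_eq_mul] at hunit hdef
  rw [Uhat_eq_smul] at hKU
  exact injectiveModRange_of_scaled ((isUnit_R ρ hz).mul (isUnit_G D Ξ Sg ρ)) hz hunit hKU hY hdef

end IsDeflatingFamily

end DeflatingFamily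

section InvariantSubspace

attribute [local instance] Matrix.normedAddCommGroup Matrix.normedSpace

variable {n k : ℕ} {s : ℕ → ℕ} {κ : Type*} [Fintype κ] [DecidableEq κ]
  {D : Matrix (Fin n) (Fin n) ℂ} {Ξ Sg : Matrix (Fin n) (JIdx k s) ℂ} {ρ : Size k}
  {E : ℝ → Matrix (JIdx k s) (JIdx k s) ℂ} {Y : ℝ → Matrix (JIdx k s) (Blk s ρ) ℂ}
  {M : ℝ → Matrix (Fin n) (Fin n) ℂ} {Φ : ℝ → Matrix (Fin n) (JIdx k s) ℂ}
  {Φc : ℝ → Matrix (Fin n) κ ℂ} {K : ℝ → Matrix (JIdx k s) (Fin n) ℂ}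
  {T : ℝ → Matrix κ (Fin n) ℂ} {C : ℝ → Matrix (JIdx k s) κ ℂ} {Bc : ℝ → Matrix κ κ ℂ}
  {B₀ : Matrix κ κ ℂ} {lam : ℂ}

namespace IsDeflatingFamily

theorem eventually_exists_mul_unscaled_eq_one (h : IsDeflatingFamily D Ξ Sg ρ E Y) :
    ∀ᶠ t in 𝓝[>] 0, ∃ A : Matrix (Blk s ρ) (JIdx k s) ℂ,
      A * unscaled D Ξ Sg ρ (root ρ t) (Y t) = 1 := by
  filter_upwards [h.rows_eq_one, eventually_coe_root_ne_zero ρ] with t hY hz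
  have hF := (Matrix.isUnit_iff_isUnit_det _).1 ((isUnit_R (s := s) ρ hz).mul (isUnit_G D Ξ Sg ρ))
  exact ⟨(blockIncl s ρ)ᵀ * (R s ρ (root ρ t) * G D Ξ Sg ρ)⁻¹, by
    rw [unscaled, Matrix.mul_assoc, Matrix.nonsing_inv_mul_cancel_left _ _ hF, hY]⟩

theorem eventually_mul_eq_mul_thetaHat (h : IsDeflatingFamily D Ξ Sg ρ E Y)
    (hM : ∀ᶠ t : ℝ in 𝓝[>] 0, IsBlockTriangularization (M t) (Φ t) (Φc t) (K t) (T t)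
      (lam • 1 + N k s + (t : ℂ) • E t) (C t) (Bc t)) :
    ∀ᶠ t in 𝓝[>] 0, M t * (Φ t * unscaled D Ξ Sg ρ (root ρ t) (Y t)) =
      Φ t * unscaled D Ξ Sg ρ (root ρ t) (Y t) *
        (lam • 1 + (root ρ t : ℂ) • thetaHat D Ξ Sg ρ (E t) (root ρ t) (Y t)) := by
  filter_upwards [hM, h.eventually_mul_unscaled, self_mem_nhdsWithin] with t hM hZ ht
  rw [coe_root_pow_self ρ ht] at hZ
  rw [← Matrix.mul_assoc, hM.map, Matrix.mul_assoc, add_assoc, Matrix.add_mul, hZ, Matrix.mul_assoc]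
  simp only [Matrix.mul_add, Matrix.mul_smul, Matrix.smul_mul, Matrix.mul_one, Matrix.one_mul]

theorem eventually_linearIndependent_col (h : IsDeflatingFamily D Ξ Sg ρ E Y)
    (hK : ∀ᶠ t in 𝓝[>] 0, K t * Φ t = 1) :
    ∀ᶠ t in 𝓝[>] 0, LinearIndependent ℂ (Φ t * unscaled D Ξ Sg ρ (root ρ t) (Y t)).col := by
  filter_upwards [hK, h.eventually_exists_mul_unscaled_eq_one] with t hK ⟨A, hA⟩
  refine linearIndependent_col_of_mul_eq_one (A := A * K t) ?_
  rw [Matrix.mul_assoc, ← Matrix.mul_assoc (K t), hK, Matrix.one_mul, hA]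

theorem exists_range_eq_spectralSubspace (h : IsDeflatingFamily D Ξ Sg ρ E Y)
    (hW : IsUnit (W D Ξ Sg ρ.1)) (hW' : IsUnit (W D Ξ Sg (ρ.1 + 1)))
    (hM : ∀ᶠ t : ℝ in 𝓝[>] 0, IsBlockTriangularization (M t) (Φ t) (Φc t) (K t) (T t)
      (lam • 1 + N k s + (t : ℂ) • E t) (C t) (Bc t))
    (hBc : Tendsto Bc (𝓝[>] 0) (𝓝 B₀)) (hlam : lam ∉ spectrum ℂ B₀) :
    ∃ c₀ C₀ : ℝ, 0 < c₀ ∧ 0 < C₀ ∧ ∀ c C : ℝ, 0 < c → c ≤ c₀ → C₀ ≤ C → ∀ᶠ t in 𝓝[>] 0,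
      LinearMap.range (Matrix.toLin' (Φ t * unscaled D Ξ Sg ρ (root ρ t) (Y t))) =
        spectralSubspace (M t) lam (c * root ρ t) (C * root ρ t) := by
  obtain ⟨c₀, C₀, hc₀, hC₀, hΘ⟩ :=
    exists_annulus_of_isUnit (h.tendsto_thetaHat hW') (splitPencil hW hW').isUnit
  refine ⟨c₀, C₀, hc₀, hC₀, fun c C hc hcc₀ hC₀C => ?_⟩
  filter_upwards [hM, hΘ, h.eventually_mul_eq_mul_thetaHat hM,
    h.eventually_injectiveModRange hW hW' hc,
    eventually_add_mul_notMem_spectrum hBc hlam (tendsto_coe_root ρ) C, self_mem_nhdsWithin]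
    with t hM hΘ hinv hinj hspec ht
  have hroot := root_pos ρ ht
  refine le_antisymm (range_le_spectralSubspace hroot.le hinv fun μ hμ =>
    ⟨hcc₀.trans (hΘ μ hμ).1, (hΘ μ hμ).2.trans hC₀C⟩)
    (spectralSubspace_le_range hroot fun μ hcμ hμC => hM.injectiveModRange (hspec μ hμC) ?_)
  rw [add_assoc, ← coe_root_pow_self ρ ht]
  exact (hinj μ hcμ hμC).smul_one_add lam

end IsDeflatingFamily

end InvariantSubspace

section Expansion

attribute [local instance] Matrix.normedAddCommGroup Matrix.normedSpace

variable {n k : ℕ} {s : ℕ → ℕ} (D : Matrix (Fin n) (Fin n) ℂ)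
  (Ξ Sg : Matrix (Fin n) (JIdx k s) ℂ) (ρ : Size k)

theorem sum_blockCol_mul {β : Type*} (Q : Matrix (JIdx k s) β ℂ) :
    ∑ i, blockCol Ξ i * ((blockIncl s i)ᵀ * Q) = Ξ * Q := by
  ext r y
  simp only [Matrix.sum_apply, Matrix.mul_apply (M := Ξ), Fintype.sum_sigma]
  refine Finset.sum_congr rfl fun i _ => ?_
  simp only [Matrix.mul_apply (M := blockCol Ξ i), blockIncl_transpose_mul_apply, blockCol]

/-- The matrix `X̃_i`: the rows of `R G Y` that belong to `i`, without their part of order one. -/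
noncomputable def correction (z : ℂ) (Y : Matrix (JIdx k s) (Blk s ρ) ℂ) (i : Size k) :
    Matrix (Blk s i) (Blk s ρ) ℂ :=
  (blockIncl s i)ᵀ * (unscaled D Ξ Sg ρ z Y - leadRows D Ξ Sg ρ)

theorem correction_apply (z : ℂ) (Y : Matrix (JIdx k s) (Blk s ρ) ℂ) (i : Size k) (x : Blk s i)
    (y : Blk s ρ) : correction D Ξ Sg ρ z Y i x y =
      unscaled D Ξ Sg ρ z Y ⟨i, x⟩ y - leadRows D Ξ Sg ρ ⟨i, x⟩ y :=
  blockIncl_transpose_mul_apply i _ x y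

theorem mul_unscaled_eq (z : ℂ) (Y : Matrix (JIdx k s) (Blk s ρ) ℂ) :
    Ξ * unscaled D Ξ Sg ρ z Y = tailFirst Ξ ρ.1 * lead D Ξ Sg ρ +
      ∑ i, blockCol Ξ i * correction D Ξ Sg ρ z Y i := by
  unfold correction
  rw [sum_blockCol_mul, Matrix.mul_sub, mul_leadRows, add_sub_cancel]

theorem correction_self {t : ℝ} (ht : 0 < t) {Y : Matrix (JIdx k s) (Blk s ρ) ℂ}
    (hY : (blockIncl s ρ)ᵀ * Y = 1) :
    correction D Ξ Sg ρ (root ρ t) Y ρ = Matrix.diagonal fun x =>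
      if x.1 = fst ρ then 0 else ((t ^ (((x.1 : ℕ) : ℝ) / (ρ.1 : ℝ)) : ℝ) : ℂ) := by
  ext x y
  have hlead : leadRows D Ξ Sg ρ ⟨ρ, x⟩ y = (0 : ℂ) ^ (x.1 : ℕ) * (1 : Matrix _ _ ℂ) x y :=
    unscaled_apply_self D Ξ Sg ρ (blockIncl_transpose_mul_self ρ) x y
  rw [correction_apply, unscaled_apply_self D Ξ Sg ρ hY, hlead, ← sub_mul, Matrix.diagonal_apply,
    ← root_pow ρ ht, Matrix.one_apply, mul_ite, mul_one, mul_zero]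
  congr 1
  split_ifs with hx
  · rw [hx, fst_val, pow_zero, pow_zero, sub_self]
  · rw [zero_pow (mt eq_fst_iff.2 hx), sub_zero, Complex.ofReal_pow]

variable {D Ξ Sg ρ} {E : ℝ → Matrix (JIdx k s) (JIdx k s) ℂ}
  {Y : ℝ → Matrix (JIdx k s) (Blk s ρ) ℂ} {i : Size k}

namespace IsDeflatingFamily

theorem isBigO_correction_of_lt (h : IsDeflatingFamily D Ξ Sg ρ E Y)
    (hW : IsUnit (W D Ξ Sg ρ.1)) (hW' : IsUnit (W D Ξ Sg (ρ.1 + 1))) (hi : i.1 < ρ.1)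
    (x : Blk s i) (y : Blk s ρ) :
    (fun t => correction D Ξ Sg ρ (root ρ t) (Y t) i x y) =O[𝓝[>] (0 : ℝ)]
      fun t : ℝ => t ^ (1 - ((i.1 : ℝ) - ((x.1 : ℕ) : ℝ)) / (ρ.1 : ℝ)) := by
  have hΘ := (splitPencil hW hW').isUnit
  have hinv := (continuousAt_matrix_inv (Theta D Ξ Sg ρ)
    (NormedRing.inverse_continuousAt ((Matrix.isUnit_iff_isUnit_det _).1 hΘ).unit)).tendsto.comp
    (h.tendsto_thetaHat hW')
  have hmul : ∀ᶠ t in 𝓝[>] 0, thetaHat D Ξ Sg ρ (E t) (root ρ t) (Y t) *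
      (thetaHat D Ξ Sg ρ (E t) (root ρ t) (Y t))⁻¹ = 1 := by
    filter_upwards [eventually_isUnit_of_tendsto (h.tendsto_thetaHat hW') hΘ] with t ht
    exact Matrix.mul_nonsing_inv _ ((Matrix.isUnit_iff_isUnit_det _).1 ht)
  have hrow := (isBigO_coe_root_pow_iff ρ).1 <| (h.isScaledChain hW').isBigO_pow_sub
    (eventually_coe_root_ne_zero ρ) (hinv.isBigO_one ℂ) hmul hi.le x.1 x.2 y
  refine hrow.congr (fun t => ?_) fun t => ?_
  · rw [correction_apply, leadRows_apply_of_not D Ξ Sg ρ (fun h' => hi.not_ge h'.1), sub_zero]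
  · rw [Nat.cast_add, Nat.cast_sub hi.le]
    congr 1
    field_simp [ρ.cast_ne_zero]
    ring

theorem isBigO_correction_fst (h : IsDeflatingFamily D Ξ Sg ρ E Y) (a : Fin (s i.1))
    (y : Blk s ρ) :
    (fun t => correction D Ξ Sg ρ (root ρ t) (Y t) i (fst i, a) y) =O[𝓝[>] (0 : ℝ)] root ρ := by
  have hG := isBigO_const_matrix_mul (G D Ξ Sg ρ) h.isBigO_Y
  refine (isBigO_matrix.1 hG ⟨i, fst i, a⟩ y).congr_left fun t => ?_
  simp only [correction_apply, unscaled_apply, leadRows_apply, ← mul_blockIncl_apply ρ,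
    fst_val, Nat.zero_sub, pow_zero, one_mul, Matrix.mul_sub, Matrix.sub_apply]

theorem isBigO_correction (h : IsDeflatingFamily D Ξ Sg ρ E Y)
    (hW' : IsUnit (W D Ξ Sg (ρ.1 + 1))) (x : Blk s i) (y : Blk s ρ) :
    (fun t => correction D Ξ Sg ρ (root ρ t) (Y t) i x y) =O[𝓝[>] (0 : ℝ)]
      fun t : ℝ => t ^ (((min (max (x.1 : ℕ) 1) ρ.1 : ℕ) : ℝ) / (ρ.1 : ℝ)) := by
  by_cases hx : (x.1 : ℕ) = 0
  · obtain ⟨l, a⟩ := x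
    obtain rfl := eq_fst_iff.2 hx
    have hmin : min (max (fst i : ℕ) 1) ρ.1 = 1 := by
      rw [fst_val, Nat.zero_max, min_eq_left ρ.one_le]
    simp only [hmin, Nat.cast_one]
    exact h.isBigO_correction_fst a y
  · rw [max_eq_left (Nat.one_le_iff_ne_zero.2 hx)]
    refine ((isBigO_coe_root_pow_iff ρ).1 <|
      (h.isScaledChain hW').isBigO_pow_min x.1.2 x.2 y).congr_left fun t => ?_
    rw [correction_apply, leadRows_apply_of_not D Ξ Sg ρ fun h' => hx h'.2, sub_zero]

theorem eventually_correction_self (h : IsDeflatingFamily D Ξ Sg ρ E Y) : ∀ᶠ t : ℝ in 𝓝[>] 0,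
    correction D Ξ Sg ρ (root ρ t) (Y t) ρ = Matrix.diagonal fun x =>
      if x.1 = fst ρ then 0 else ((t ^ (((x.1 : ℕ) : ℝ) / (ρ.1 : ℝ)) : ℝ) : ℂ) := by
  filter_upwards [h.rows_eq_one, self_mem_nhdsWithin] with t hY ht
  exact correction_self D Ξ Sg ρ ht hY

theorem isO_sub_expansion (h : IsDeflatingFamily D Ξ Sg ρ E Y) {κ : Type*} [Fintype κ]
    {Ξc : Matrix (Fin n) κ ℂ} {P : ℝ → Matrix κ (JIdx k s) ℂ} (hP : IsO P 1) :
    IsO (fun t => (Ξ + Ξc * P t) * unscaled D Ξ Sg ρ (root ρ t) (Y t) -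
      (tailFirst Ξ ρ.1 * lead D Ξ Sg ρ +
        ∑ i, blockCol Ξ i * correction D Ξ Sg ρ (root ρ t) (Y t) i)) 1 := by
  intro r y
  have hΞP := isBigO_matrix.1 (isBigO_const_matrix_mul Ξc (isBigO_matrix.2 hP)) r
  have hZ := isBigO_matrix.1 (h.tendsto_unscaled.isBigO_one ℝ)
  refine (isBigO_mul_apply hΞP (hZ · y)).congr (fun t => ?_) fun t => mul_one _
  simp only [← mul_unscaled_eq, ← Matrix.sub_mul, add_sub_cancel_left]

theorem isO_thetaHat_sub_Theta (h : IsDeflatingFamily D Ξ Sg ρ E Y)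
    (hW' : IsUnit (W D Ξ Sg (ρ.1 + 1))) :
    IsO (fun t => thetaHat D Ξ Sg ρ (E t) (root ρ t) (Y t) - Theta D Ξ Sg ρ) (1 / (ρ.1 : ℝ)) :=
  isBigO_matrix.1 (isBigO_thetaHat_sub_Theta hW' h.isBigO_E h.isBigO_Y)

theorem eventually_apply_self (h : IsDeflatingFamily D Ξ Sg ρ E Y) :
    ∀ᶠ t in 𝓝[>] 0, ∀ x y, Y t ⟨ρ, x⟩ y = (1 : Matrix _ _ ℂ) x y := by
  filter_upwards [h.rows_eq_one] with t hY x y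
  rw [← blockIncl_transpose_mul_apply ρ (Y t), hY]

theorem isBigO_apply_of_ne (h : IsDeflatingFamily D Ξ Sg ρ E Y) {p : JIdx k s} (hp : p.1 ≠ ρ)
    (y : Blk s ρ) : (fun t => Y t p y) =O[𝓝[>] (0 : ℝ)] root ρ :=
  (isBigO_matrix.1 h.isBigO_Y p y).congr_left fun t => by
    rw [Matrix.sub_apply, blockIncl_apply_of_ne hp, Pi.zero_apply, sub_zero]

end IsDeflatingFamily

end Expansion

section Decoupling

attribute [local instance] Matrix.normedAddCommGroup Matrix.normedSpace

variable {k : ℕ} {s : ℕ → ℕ} {κ : Type*} {P : ℝ → Matrix κ (JIdx k s) ℂ}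

theorem disjoint_spectrum_of_notMem [Fintype κ] [DecidableEq κ] {A₂₂ : Matrix κ κ ℂ} {lam : ℂ}
    (hlam : lam ∉ spectrum ℂ A₂₂) :
    Disjoint (spectrum ℂ A₂₂) (spectrum ℂ (lam • 1 + N k s)) :=
  Set.disjoint_left.2 fun _ h₂₂ hN =>
    hlam (eq_of_mem_spectrum_smul_one_add isNilpotent_N hN ▸ h₂₂)

theorem isBigO_decoupled_sub [Fintype κ] (ρ : Size k) (hP : IsO P 1)
    (D₁₁ : Matrix (JIdx k s) (JIdx k s) ℂ) (D₁₂ : Matrix (JIdx k s) κ ℂ) :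
    (fun t => D₁₁ + D₁₂ * P t - D₁₁) =O[𝓝[>] 0] root ρ := by
  simpa only [add_sub_cancel_left] using
    (isBigO_const_matrix_mul D₁₂ (isBigO_matrix.2 hP)).trans (isBigO_rpow_one_root ρ)

theorem tendsto_decoupled_complement [Finite κ] (hP : IsO P 1) (A₂₂ D₂₂ : Matrix κ κ ℂ)
    (D₁₂ : Matrix (JIdx k s) κ ℂ) :
    Tendsto (fun t : ℝ => A₂₂ + (t : ℂ) • (D₂₂ - P t * D₁₂)) (𝓝[>] 0) (𝓝 A₂₂) := by
  have := Fintype.ofFinite κ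
  have ht : Tendsto (fun t : ℝ => t) (𝓝[>] 0) (𝓝 0) := tendsto_id.mono_left nhdsWithin_le_nhds
  have hP0 : Tendsto P (𝓝[>] 0) (𝓝 0) :=
    (isBigO_matrix.2 hP).trans_tendsto (by simpa only [Real.rpow_one] using ht)
  have hcont : Continuous fun q : ℂ × Matrix κ (JIdx k s) ℂ => A₂₂ + q.1 • (D₂₂ - q.2 * D₁₂) := by
    fun_prop
  have hlim := (hcont.tendsto (0, 0)).comp (ht.ofReal.prodMk_nhds hP0)
  simpa only [Function.comp_def, zero_smul, add_zero] using hlim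

end Decoupling

end JordanPert

open JordanPert in
theorem theorem3p1_general
    {n m k : ℕ} (s : ℕ → ℕ)
    (A D : Matrix (Fin n) (Fin n) ℂ) (lam : ℂ)
    (Ξ Sg : Matrix (Fin n) (JIdx k s) ℂ)
    (Ξc Sgc : Matrix (Fin n) (Fin m) ℂ)
    (A₂₂ : Matrix (Fin m) (Fin m) ℂ)
    (hinv_left : (Matrix.fromCols Sg Sgc)ᴴ * Matrix.fromCols Ξ Ξc = 1)
    (hinv_right : Matrix.fromCols Ξ Ξc * (Matrix.fromCols Sg Sgc)ᴴ = 1)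
    (hA : A * Matrix.fromCols Ξ Ξc = Matrix.fromCols Ξ Ξc *
      Matrix.fromBlocks (lam • (1 : Matrix _ _ ℂ) + N k s) 0 0 A₂₂)
    (hA₂₂ : lam ∉ spectrum ℂ A₂₂)
    (ρ : Size k) (hW : IsUnit (W D Ξ Sg ρ.1)) (hW' : IsUnit (W D Ξ Sg (ρ.1 + 1))) :
    ∃ (X : ℝ → Matrix (Fin n) (Blk s ρ) ℂ)
      (ThetaHat : ℝ → Matrix (Blk s ρ) (Blk s ρ) ℂ)
      (Xt : ℝ → (i : Size k) → Matrix (Blk s i) (Blk s ρ) ℂ)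
      (P : ℝ → Matrix (Fin m) (JIdx k s) ℂ)
      (Y : ℝ → Matrix (JIdx k s) (Blk s ρ) ℂ),
      (∀ᶠ t : ℝ in 𝓝[>] 0,
        (A + (t : ℂ) • D) * X t
          = X t * (lam • (1 : Matrix _ _ ℂ) + (root ρ t : ℂ) • ThetaHat t) ∧
        LinearIndependent ℂ (X t).col) ∧
      (∃ c₀ C₀ : ℝ, 0 < c₀ ∧ 0 < C₀ ∧ ∀ c C : ℝ, 0 < c → c ≤ c₀ → C₀ ≤ C →
        ∀ᶠ t : ℝ in 𝓝[>] 0,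
          LinearMap.range (Matrix.toLin' (X t)) =
            spectralSubspace (A + (t : ℂ) • D) lam
              (c * root ρ t) (C * root ρ t)) ∧
      IsO (fun t => ThetaHat t - Theta D Ξ Sg ρ) (1 / (ρ.1 : ℝ)) ∧
      IsO (fun t => X t - (tailFirst Ξ ρ.1 * lead D Ξ Sg ρ
        + ∑ i : Size k, blockCol Ξ i * Xt t i)) 1 ∧
      (∀ᶠ t : ℝ in 𝓝[>] 0, Xt t ρ = Matrix.diagonal fun x =>
        if x.1 = fst ρ then 0 else ((t ^ (((x.1 : ℕ) : ℝ) / (ρ.1 : ℝ)) : ℝ) : ℂ)) ∧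
      (∀ i : Size k, i.1 < ρ.1 → ∀ x y,
        (fun t => Xt t i x y) =O[𝓝[>] (0 : ℝ)]
          fun t : ℝ => t ^ (1 - ((i.1 : ℝ) - ((x.1 : ℕ) : ℝ)) / (ρ.1 : ℝ))) ∧
      (∀ i : Size k, ρ.1 < i.1 → ∀ x y,
        (fun t => Xt t i x y) =O[𝓝[>] (0 : ℝ)]
          fun t : ℝ => t ^ (((min (max (x.1 : ℕ) 1) ρ.1 : ℕ) : ℝ) / (ρ.1 : ℝ))) ∧
      IsO P 1 ∧
      (∀ᶠ t : ℝ in 𝓝[>] 0,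
        (A₂₂ + (t : ℂ) • (Sgcᴴ * D * Ξc)) * P t
          - P t * (lam • (1 : Matrix _ _ ℂ) + N k s + (t : ℂ) • (Sgᴴ * D * Ξ))
          - (t : ℂ) • (P t * (Sgᴴ * D * Ξc) * P t) + (t : ℂ) • (Sgcᴴ * D * Ξ) = 0) ∧
      (∀ᶠ t : ℝ in 𝓝[>] 0, ∀ x y, Y t ⟨ρ, x⟩ y = (1 : Matrix _ _ ℂ) x y) ∧
      (∀ p : JIdx k s, p.1 ≠ ρ → ∀ y,
        (fun t => Y t p y) =O[𝓝[>] (0 : ℝ)] fun t : ℝ => t ^ (1 / (ρ.1 : ℝ))) ∧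
      (∀ᶠ t : ℝ in 𝓝[>] 0,
        Uhat D Ξ Sg ρ (root ρ t) * Y t * ThetaHat t
          = Vhat D Ξ Sg (Sgᴴ * D * Ξ + Sgᴴ * D * Ξc * P t) ρ
              (root ρ t) * Y t ∧
        (∀ x y, ThetaHat t x y
          = (Vhat D Ξ Sg (Sgᴴ * D * Ξ + Sgᴴ * D * Ξc * P t) ρ
              (root ρ t) * Y t) ⟨ρ, x⟩ y) ∧
        X t = (Ξ + Ξc * P t) *
          (R s ρ (root ρ t) * G D Ξ Sg ρ * Y t)) := by
  have htri : IsBlockTriangularization A Ξ Ξc Sgᴴ Sgcᴴ (lam • 1 + N k s) 0 A₂₂ := by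
    rw [Matrix.conjTranspose_fromCols_eq_fromRows_conjTranspose] at hinv_left hinv_right
    exact .of_fromCols hinv_left hinv_right hA
  obtain ⟨P, hP, hric⟩ := exists_riccati (disjoint_spectrum_of_notMem hA₂₂)
    (Sgᴴ * D * Ξ) (Sgᴴ * D * Ξc) (Sgcᴴ * D * Ξ) (Sgcᴴ * D * Ξc)
  have hM := hric.mono fun t ht => htri.add_smul_of_riccati ht
  obtain ⟨Y, h⟩ := exists_isDeflatingFamily hW hW'
    (isBigO_decoupled_sub ρ hP (Sgᴴ * D * Ξ) (Sgᴴ * D * Ξc))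
  exact ⟨fun t => (Ξ + Ξc * P t) * unscaled D Ξ Sg ρ (root ρ t) (Y t),
    fun t => thetaHat D Ξ Sg ρ (Sgᴴ * D * Ξ + Sgᴴ * D * Ξc * P t) (root ρ t) (Y t),
    fun t => correction D Ξ Sg ρ (root ρ t) (Y t), P, Y,
    (h.eventually_mul_eq_mul_thetaHat hM).and
      (h.eventually_linearIndependent_col (hM.mono fun _ ht => ht.S_mul)),
    h.exists_range_eq_spectralSubspace hW hW' hM (tendsto_decoupled_complement hP _ _ _) hA₂₂,
    h.isO_thetaHat_sub_Theta hW', h.isO_sub_expansion hP, h.eventually_correction_self,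
    fun _ hi => h.isBigO_correction_of_lt hW hW' hi, fun _ _ => h.isBigO_correction hW',
    hP, hric, h.eventually_apply_self, fun _ hp => h.isBigO_apply_of_ne hp,
    h.deflates.mono fun _ hdef => ⟨hdef, blockIncl_transpose_mul_apply ρ _, rfl⟩⟩

theorem theorem3p1
    {n m k : ℕ} (s : ℕ → ℕ) (hs : 0 < s k)
    (A D : Matrix (Fin n) (Fin n) ℂ) (lam : ℂ)
    (Ξ Sg : Matrix (Fin n) (JordanPert.JIdx k s) ℂ)
    (Ξc Sgc : Matrix (Fin n) (Fin m) ℂ)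
    (A₂₂ : Matrix (Fin m) (Fin m) ℂ)
    -- `[Ξ Ξc]` is invertible and `[Sg Sgc]` is the conjugate transpose of its inverse
    (hinv_left : (Matrix.fromCols Sg Sgc)ᴴ * Matrix.fromCols Ξ Ξc = 1)
    (hinv_right : Matrix.fromCols Ξ Ξc * (Matrix.fromCols Sg Sgc)ᴴ = 1)
    (hA : A * Matrix.fromCols Ξ Ξc = Matrix.fromCols Ξ Ξc *
      Matrix.fromBlocks (lam • (1 : Matrix _ _ ℂ) + JordanPert.N k s) 0 0 A₂₂)
    (hA₂₂ : lam ∉ spectrum ℂ A₂₂)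
    (ρ : JordanPert.Size k)
    -- `W_{k+1}` is the empty matrix, so this is a condition on `W_1, …, W_{min(ρ+1,k)}`
    (hW : ∀ i : ℕ, 1 ≤ i → i ≤ ρ.1 + 1 → IsUnit (JordanPert.W D Ξ Sg i)) :
    ∃ (X : ℝ → Matrix (Fin n) (JordanPert.Blk s ρ) ℂ)
      (ThetaHat : ℝ → Matrix (JordanPert.Blk s ρ) (JordanPert.Blk s ρ) ℂ)
      (Xt : ℝ → (i : JordanPert.Size k) → Matrix (JordanPert.Blk s i) (JordanPert.Blk s ρ) ℂ)
      (P : ℝ → Matrix (Fin m) (JordanPert.JIdx k s) ℂ)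
      (Y : ℝ → Matrix (JordanPert.JIdx k s) (JordanPert.Blk s ρ) ℂ),
      -- the invariance relation, with a basis matrix `X`
      (∀ᶠ t : ℝ in 𝓝[>] 0,
        (A + (t : ℂ) • D) * X t
          = X t * (lam • (1 : Matrix _ _ ℂ) + (JordanPert.root ρ t : ℂ) • ThetaHat t) ∧
        LinearIndependent ℂ (X t).col) ∧
      -- the range of `X` belongs to all the eigenvalues of order `t^{1/ρ}`
      (∃ c₀ C₀ : ℝ, 0 < c₀ ∧ 0 < C₀ ∧ ∀ c C : ℝ, 0 < c → c ≤ c₀ → C₀ ≤ C →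
        ∀ᶠ t : ℝ in 𝓝[>] 0,
          LinearMap.range (Matrix.toLin' (X t)) =
            JordanPert.spectralSubspace (A + (t : ℂ) • D) lam
              (c * JordanPert.root ρ t) (C * JordanPert.root ρ t)) ∧
      -- the order of `ThetaHat - Theta`
      JordanPert.IsO (fun t => ThetaHat t - JordanPert.Theta D Ξ Sg ρ) (1 / (ρ.1 : ℝ)) ∧
      -- the expansion of `X`
      JordanPert.IsO (fun t => X t - (JordanPert.tailFirst Ξ ρ.1 * JordanPert.lead D Ξ Sg ρ
        + ∑ i : JordanPert.Size k, JordanPert.blockCol Ξ i * Xt t i)) 1 ∧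
      (∀ᶠ t : ℝ in 𝓝[>] 0, Xt t ρ = Matrix.diagonal fun x =>
        if x.1 = JordanPert.fst ρ then 0 else ((t ^ (((x.1 : ℕ) : ℝ) / (ρ.1 : ℝ)) : ℝ) : ℂ)) ∧
      (∀ i : JordanPert.Size k, i.1 < ρ.1 → ∀ x y,
        (fun t => Xt t i x y) =O[𝓝[>] (0 : ℝ)]
          fun t : ℝ => t ^ (1 - ((i.1 : ℝ) - ((x.1 : ℕ) : ℝ)) / (ρ.1 : ℝ))) ∧
      (∀ i : JordanPert.Size k, ρ.1 < i.1 → ∀ x y,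
        (fun t => Xt t i x y) =O[𝓝[>] (0 : ℝ)]
          fun t : ℝ => t ^ (((min (max (x.1 : ℕ) 1) ρ.1 : ℕ) : ℝ) / (ρ.1 : ℝ))) ∧
      -- the definition of `ThetaHat` and `X` through the scaled pencil:
      -- `P` is the solution of order `t` of the Riccati equation that decouples `lam` from the
      -- other eigenvalues,
      JordanPert.IsO P 1 ∧
      (∀ᶠ t : ℝ in 𝓝[>] 0,
        (A₂₂ + (t : ℂ) • (Sgcᴴ * D * Ξc)) * P t
          - P t * (lam • (1 : Matrix _ _ ℂ) + JordanPert.N k s + (t : ℂ) • (Sgᴴ * D * Ξ))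
          - (t : ℂ) • (P t * (Sgᴴ * D * Ξc) * P t) + (t : ℂ) • (Sgcᴴ * D * Ξ) = 0) ∧
      -- `Y` has block rows `X₁`, `I`, `X₂` with `X₁` and `X₂` of order `t^{1/ρ}`,
      (∀ᶠ t : ℝ in 𝓝[>] 0, ∀ x y, Y t ⟨ρ, x⟩ y = (1 : Matrix _ _ ℂ) x y) ∧
      (∀ p : JordanPert.JIdx k s, p.1 ≠ ρ → ∀ y,
        (fun t => Y t p y) =O[𝓝[>] (0 : ℝ)] fun t : ℝ => t ^ (1 / (ρ.1 : ℝ))) ∧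
      -- it is a matrix of a deflating subspace of the pencil, `ThetaHat` is the block row
      -- of `V̂(z) Y` that belongs to `ρ`, and `X` is obtained from `Y` by undoing the scalings
      (∀ᶠ t : ℝ in 𝓝[>] 0,
        JordanPert.Uhat D Ξ Sg ρ (JordanPert.root ρ t) * Y t * ThetaHat t
          = JordanPert.Vhat D Ξ Sg (Sgᴴ * D * Ξ + Sgᴴ * D * Ξc * P t) ρ
              (JordanPert.root ρ t) * Y t ∧
        (∀ x y, ThetaHat t x y
          = (JordanPert.Vhat D Ξ Sg (Sgᴴ * D * Ξ + Sgᴴ * D * Ξc * P t) ρ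
              (JordanPert.root ρ t) * Y t) ⟨ρ, x⟩ y) ∧
        X t = (Ξ + Ξc * P t) *
          (JordanPert.R s ρ (JordanPert.root ρ t) * JordanPert.G D Ξ Sg ρ * Y t)) :=
  theorem3p1_general s A D lam Ξ Sg Ξc Sgc A₂₂ hinv_left hinv_right hA hA₂₂ ρ
    (hW _ ρ.one_le (Nat.le_succ _)) (hW _ (Nat.le_add_left _ _) le_rfl)
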